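/- Let $M\ge 1$ and $p\ge 2$ be integers such that $L=\frac{M}{p}$ is an integer. Let $F_M$ be the normalized $M\times M$ DFT matrix, $F_M[m,n]=\frac{1}{\sqrt M}e^{-2\pi j\frac{mn}{M}}$ for $m,n\in\{0,\dots,M-1\}$ with $j^2=-1$. Let $F_{M|p}$ be an $L\times L$ submatrix of $F_M$ obtained by deleting any consecutive $M-L$ columns and any consecutive $M-L$ rows of $F_M$ (consecutive in the cyclic order, in which index $0$ follows index $M-1$; the remaining $L$ rows and the remaining $L$ columns are then cyclically consecutive as well). Let $\sigma^{(0)}\ge\sigma^{(1)}\ge\cdots\ge\sigma^{(L-1)}$ denote the singular values of $F_{M|p}$. For $\epsilon\in(0,\frac12)$ put \[ R(L,M,\epsilon)=\left(\frac{4}{\pi^2}\log(8L)+6\right)\log\left(\frac{16}{\epsilon}\right)+2\max\left(\frac{-\log\left(8\pi\left(\left(\frac{M}{L}\right)^2-1\right)\epsilon\right)}{\log\left(\frac{M}{L}\right)},\,0\right). \] Then for every $\epsilon\in(0,\frac12)$, \[ \sigma^{(2\lfloor \frac{L}{2p}\rfloor-R(L,M,\epsilon))}\ge\sqrt{1-\epsilon},\qquad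 \sigma^{(2\lfloor \frac{L}{2p}\rfloor+R(L,M,\epsilon)+1)}\le\sqrt{\epsilon}, \] and \[ \#\left\{\ell:\ \sqrt\epsilon<\sigma^{(\ell)}<\sqrt{1-\epsilon}\right\}\le 2R(L,M,\epsilon). \] As $R(L,M,\epsilon)$ need not be an integer, the first two inequalities mean: $\sigma^{(\ell)}\ge\sqrt{1-\epsilon}$ for all $\ell\in\{0,\dots,L-1\}$ with $\ell\le\left\lceil 2\lfloor\frac{L}{2p}\rfloor-R(L,M,\epsilon)\right\rceil$, and $\sigma^{(\ell)}\le\sqrt\epsilon$ for all $\ell\in\{0,\dots,L-1\}$ with $\ell\ge\left\lfloor 2\lfloor\frac{L}{2p}\rfloor+R(L,M,\epsilon)+1\right\rfloor$. -/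

import Mathlib

noncomputable section

/-- The normalized `M`-point DFT matrix, with entries `e^{-2πj mn/M} / √M` for `0 ≤ m, n < M`. -/
def dftMatrix (M : ℕ) : Matrix (Fin M) (Fin M) ℂ :=
  Matrix.of fun m n =>
    (1 / (Real.sqrt M : ℂ)) *
      Complex.exp (-(2 * Real.pi * Complex.I * ((m : ℕ) : ℂ) * ((n : ℕ) : ℂ)) / (M : ℂ))

/-- The increasing selection `s` of `L` indices out of `{0, …, M - 1}` selects `L` consecutive
indices, where the index `0` is taken to follow the index `M - 1`. For `1 ≤ L ≤ M` these are
exactly the selections that remain when `M - L` indices, consecutive in the same cyclic sense, are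
deleted; selections without wrap-around, and the ones left by deleting an interval of indices, are
both covered. -/
def SelectsConsecutive {L M : ℕ} (s : Fin L ↪o Fin M) : Prop :=
  ∃ a : ℕ, ∀ i : Fin M, i ∈ Set.range s ↔ ∃ t : ℕ, t < L ∧ (i : ℕ) = (a + t) % M

/-- The singular values of a complex matrix in decreasing order, with multiplicity and indexed
from `0`; a matrix with `L` columns has the singular values with index `ℓ < L`. -/
def singularValue {k l : ℕ} (A : Matrix (Fin k) (Fin l) ℂ) (ℓ : ℕ) : ℝ :=
  (Matrix.toEuclideanLin A).singularValues ℓ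

/-- The quantity `R(N, M, ε)`, which bounds half the width of the transition region. -/
def transitionBound (N M : ℕ) (ε : ℝ) : ℝ :=
  (4 / Real.pi ^ 2 * Real.log (8 * N) + 6) * Real.log (16 / ε) +
    2 * max (-Real.log (8 * Real.pi * (((M : ℝ) / N) ^ 2 - 1) * ε) / Real.log ((M : ℝ) / N)) 0

end

/-!
Let `A` be the `L × L` submatrix and `λ = σ²` the eigenvalues of `A* A`. They sum to
`L² / M = L / p`, so the place where they drop from near `1` to near `0` is known once two facts
about `∑ λ (1 - λ)` and about the number of `λ` in `(ε, 1 - ε)` are available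
(`transition_location`): the number of `λ > 1/2` differs from the sum of the `λ` by at most
`2 ∑ λ (1 - λ)`, and all claims follow if the count in `(ε, 1 - ε)`, plus this deviation, plus `1`,
is at most `R(L, M, ε)`.

Both facts come from the identity `A* A - (A* A)² = X X*`, where `X` is the block, between the
selected and the remaining columns, of the projection onto the span of the selected rows
(`defect_submatrix`). Its entries are a phase times `sin (L θ) / (M sin θ)`, with `θ` equal to `π/M`
times the distance of the two columns. Summing their squares gives
`∑ λ (1 - λ) ≤ (2/π²) (2 + log L) + 1/4` (`sum_mul_one_sub_singularValue_dft_le`).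

For the count, a Möbius transformation of the circle (`cauchyCoord`) sends the selected columns to
positive points `y` and the others to points `-Y`, with `y` and `Y` in `[1/(2L+1), 2L+1]`, and
turns `X` into a matrix of Cauchy type `(∑ α β) / (y + Y)` with a numerator of rank two
(`exists_rowKernel_mul_sub_eq`). For a rational function `r(y) = ∏ (y - s) / (y + s)` with `k`
nodes `s`, `(1 - r(y) r(Y)) / (y + Y)` is a sum of `k` separated products
(`one_sub_nodeRatio_mul`), so `X` differs from `r(Y) X r(y)` by a matrix of rank at most `2 k`.
With `δ` the maximum of `|r|` and `‖X‖² ≤ 1/4`, at most `2 k` of the numbers `λ (1 - λ)` exceed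
`δ⁴ / 4` (`card_transition_le`).

Nodes in geometric progression with ratio `e^h` are good enough: each factor is at most
`exp (-2 min (y/s, s/y))`, and two geometric series give, up to the truncation,
`δ ≤ exp (-2 / sinh (h/2))` (`le_sum_exp_neg_abs`). The choice `h = 15 / log (16/ε)` makes
`δ⁴ / 4 ≤ ε / 2 < ε (1 - ε)` with
`2 k ≤ (4/15) (log (2L+1) + log 16) log (16/ε) + 10` (`exists_nodes`). As `4/15 < 4/π²`, this leaves
room in `R(L, M, ε)` for the deviation term, which is of order `(4/π²) log L`
(`budget_le_transitionBound`).
-/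

open scoped InnerProductSpace ComplexConjugate Matrix

/-! ### The singular values of an operator and the form of `T* T - (T* T)²` -/

section Spectral

variable {V W : Type*} [NormedAddCommGroup V] [InnerProductSpace ℂ V] [FiniteDimensional ℂ V]
  [NormedAddCommGroup W] [InnerProductSpace ℂ W] [FiniteDimensional ℂ W]

/-- Right singular vectors, numbered so that the `i`-th belongs to the `i`-th singular value. -/
theorem exists_singular_basis (T : V →ₗ[ℂ] W) {n : ℕ} (hn : Module.finrank ℂ V = n) :
    ∃ b : OrthonormalBasis (Fin n) ℂ V, ∀ i,
      T.adjoint (T (b i)) = ((T.singularValues i ^ 2 : ℝ) : ℂ) • b i := by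
  refine ⟨T.isSymmetric_adjoint_comp_self.eigenvectorBasis hn, fun i => ?_⟩
  have := T.isSymmetric_adjoint_comp_self.apply_eigenvectorBasis hn i
  rw [T.sq_singularValues_fin hn]
  rw [LinearMap.comp_apply] at this
  exact this

/-- The quadratic form of `T* T - (T* T)²`. -/
noncomputable def defect (T : V →ₗ[ℂ] W) (v : V) : ℝ := ‖T v‖ ^ 2 - ‖T.adjoint (T v)‖ ^ 2

/-- By completing the square, as `x - x² ≤ 1/4`. -/
theorem defect_le_quarter (T : V →ₗ[ℂ] W) (v : V) : defect T v ≤ 1 / 4 * ‖v‖ ^ 2 := by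
  have h1 : ‖T.adjoint (T v) - (1 / 2 : ℂ) • v‖ ^ 2 =
      ‖T.adjoint (T v)‖ ^ 2 - ‖T v‖ ^ 2 + 1 / 4 * ‖v‖ ^ 2 := by
    rw [@norm_sub_sq ℂ, inner_smul_right, LinearMap.adjoint_inner_left, norm_smul,
      inner_self_eq_norm_sq_to_K, mul_pow]
    have : RCLike.re ((1 / 2 : ℂ) * ((‖T v‖ : ℂ)) ^ 2) = 1 / 2 * ‖T v‖ ^ 2 := by
      rw [show ((1 / 2 : ℂ) * ((‖T v‖ : ℂ)) ^ 2) = ((1 / 2 * ‖T v‖ ^ 2 : ℝ) : ℂ) by push_cast; ring]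
      exact Complex.ofReal_re _
    have h2 : ‖(1 / 2 : ℂ)‖ = 1 / 2 := by norm_num
    rw [h2]
    erw [this]
    ring
  have := sq_nonneg ‖T.adjoint (T v) - (1 / 2 : ℂ) • v‖
  unfold defect
  linarith

theorem adjoint_comp_self_sum (T : V →ₗ[ℂ] W) {n : ℕ} (b : OrthonormalBasis (Fin n) ℂ V)
    (hb : ∀ i, T.adjoint (T (b i)) = ((T.singularValues i ^ 2 : ℝ) : ℂ) • b i) (c : Fin n → ℂ) :
    T.adjoint (T (∑ i, c i • b i)) = ∑ i : Fin n,
      (((T.singularValues i ^ 2 : ℝ) : ℂ) * c i) • b i := by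
  simp only [map_sum, map_smul, hb, smul_smul, mul_comm]

omit [FiniteDimensional ℂ V] in
theorem norm_sq_sum_orthonormal {n : ℕ} (b : OrthonormalBasis (Fin n) ℂ V) (c : Fin n → ℂ) :
    ‖∑ i, c i • b i‖ ^ 2 = ∑ i, ‖c i‖ ^ 2 := by
  rw [← OrthonormalBasis.sum_sq_norm_inner_right b]
  refine Finset.sum_congr rfl fun i _ => ?_
  rw [Orthonormal.inner_right_fintype b.orthonormal]

theorem defect_sum (T : V →ₗ[ℂ] W) {n : ℕ} (b : OrthonormalBasis (Fin n) ℂ V)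
    (hb : ∀ i, T.adjoint (T (b i)) = ((T.singularValues i ^ 2 : ℝ) : ℂ) • b i) (c : Fin n → ℂ) :
    defect T (∑ i, c i • b i) =
      ∑ i : Fin n, T.singularValues i ^ 2 * (1 - T.singularValues i ^ 2) * ‖c i‖ ^ 2 := by
  have h1 : ‖T (∑ i, c i • b i)‖ ^ 2 = ∑ i : Fin n, T.singularValues i ^ 2 * ‖c i‖ ^ 2 := by
    have : ⟪T (∑ i, c i • b i), T (∑ i, c i • b i)⟫_ℂ =
        ((∑ i : Fin n, T.singularValues i ^ 2 * ‖c i‖ ^ 2 : ℝ) : ℂ) := by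
      rw [← LinearMap.adjoint_inner_right, adjoint_comp_self_sum T b hb,
        b.orthonormal.inner_sum]
      push_cast
      refine Finset.sum_congr rfl fun i _ => ?_
      rw [mul_left_comm, Complex.conj_mul']
    rw [inner_self_eq_norm_sq_to_K] at this
    exact Complex.ofReal_injective ((Complex.ofReal_pow _ 2).trans this)
  unfold defect
  rw [h1, adjoint_comp_self_sum T b hb, norm_sq_sum_orthonormal, ← Finset.sum_sub_distrib]
  refine Finset.sum_congr rfl fun i _ => ?_
  rw [norm_mul, Complex.norm_real, mul_pow, Real.norm_eq_abs, sq_abs]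
  ring

theorem mul_one_sub_sq_singularValues_nonneg (T : V →ₗ[ℂ] W) {n : ℕ}
    (hn : Module.finrank ℂ V = n) (hT : ∀ v, 0 ≤ defect T v) (i : Fin n) :
    0 ≤ T.singularValues i ^ 2 * (1 - T.singularValues i ^ 2) := by
  obtain ⟨b, hb⟩ := exists_singular_basis T hn
  have h := hT (∑ j, (Pi.single i 1 : Fin n → ℂ) j • b j)
  rw [defect_sum T b hb, Finset.sum_eq_single i (fun j _ hj => by simp [hj]) (by simp)] at h
  simpa using h

/-- If the quadratic form of `T* T - (T* T)²` is at most `θ` on the common kernel of `r`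
functionals, then at most `r` eigenvalues of that operator exceed `θ`. -/
theorem card_defect_eigenvalues_le (T : V →ₗ[ℂ] W) {n : ℕ} (hn : Module.finrank ℂ V = n)
    {ι : Type*} [Fintype ι] (Φ : V →ₗ[ℂ] (ι → ℂ)) (θ : ℝ)
    (hΦ : ∀ v, Φ v = 0 → defect T v ≤ θ * ‖v‖ ^ 2) :
    (Finset.univ.filter fun i : Fin n =>
      θ < T.singularValues i ^ 2 * (1 - T.singularValues i ^ 2)).card ≤ Fintype.card ι := by
  classical
  obtain ⟨b, hb⟩ := exists_singular_basis T hn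
  set S := Finset.univ.filter fun i : Fin n =>
      θ < T.singularValues i ^ 2 * (1 - T.singularValues i ^ 2) with hS
  by_contra! hcard
  have hker : LinearMap.ker (Φ ∘ₗ Fintype.linearCombination ℂ fun i : S => b i) ≠ ⊥ := by
    apply LinearMap.ker_ne_bot_of_finrank_lt
    simpa using hcard
  obtain ⟨c, hc, hc0⟩ := (Submodule.ne_bot_iff _).1 hker
  set d : Fin n → ℂ := fun i => if h : i ∈ S then c ⟨i, h⟩ else 0 with hd
  have hdS : ∀ i : S, d i = c i := fun i => by simp [hd]
  have hdn : ∀ i, i ∉ S → d i = 0 := fun i hi => by simp [hd, hi]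
  have hsum : ∑ i : S, c i • b i = ∑ i, d i • b i := by
    rw [← Finset.sum_subset (Finset.subset_univ S) (fun i _ hi => by simp [hdn i hi]),
      ← Finset.sum_coe_sort S]
    exact Finset.sum_congr rfl fun i _ => by rw [hdS]
  have h1 := hΦ (∑ i, d i • b i) (by
    rw [LinearMap.mem_ker, LinearMap.comp_apply, Fintype.linearCombination_apply, hsum] at hc
    exact hc)
  rw [defect_sum T b hb, norm_sq_sum_orthonormal, Finset.mul_sum] at h1
  obtain ⟨i₀, hi₀⟩ := Function.ne_iff.1 hc0
  refine absurd h1 (not_le.2 (Finset.sum_lt_sum (fun i _ => ?_) ⟨i₀, Finset.mem_univ _, ?_⟩))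
  · by_cases hi : i ∈ S
    · have := (Finset.mem_filter.1 hi).2
      gcongr
    · simp [hdn i hi]
  · have h2 := (Finset.mem_filter.1 i₀.2).2
    have h3 : 0 < ‖d i₀‖ ^ 2 := by
      rw [hdS]; exact pow_pos (norm_pos_iff.2 hi₀) 2
    gcongr

/-- The trace of `T* T`, computed in an arbitrary orthonormal basis. -/
theorem sum_norm_sq_apply (T : V →ₗ[ℂ] W) {n : ℕ} (hn : Module.finrank ℂ V = n)
    {ι : Type*} [Fintype ι] (e : OrthonormalBasis ι ℂ V) :
    ∑ i, ‖T (e i)‖ ^ 2 = ∑ i : Fin n, T.singularValues i ^ 2 := by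
  obtain ⟨b, hb⟩ := exists_singular_basis T hn
  have key : ∀ {κ : Type _} [Fintype κ] (f : OrthonormalBasis κ ℂ V),
      LinearMap.trace ℂ V (T.adjoint ∘ₗ T) = ((∑ i, ‖T (f i)‖ ^ 2 : ℝ) : ℂ) := by
    intro κ _ f
    rw [LinearMap.trace_eq_sum_inner _ f]
    rw [Complex.ofReal_sum]
    refine Finset.sum_congr rfl fun i _ => ?_
    rw [LinearMap.comp_apply, LinearMap.adjoint_inner_right, inner_self_eq_norm_sq_to_K]
    simp
  have h := (key e).symm.trans
    (LinearMap.trace_eq_sum_inner (T.adjoint ∘ₗ T) b)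
  have h2 : ∑ i, ⟪b i, (T.adjoint ∘ₗ T) (b i)⟫_ℂ =
      ((∑ i : Fin n, T.singularValues i ^ 2 : ℝ) : ℂ) := by
    rw [Complex.ofReal_sum]
    refine Finset.sum_congr rfl fun i _ => ?_
    rw [LinearMap.comp_apply, hb, inner_smul_right, inner_self_eq_norm_sq_to_K, b.norm_eq_one]
    simp
  rw [h2] at h
  exact_mod_cast h

/-- The trace of `T* T - (T* T)²`, computed in an arbitrary orthonormal basis. -/
theorem sum_defect_apply (T : V →ₗ[ℂ] W) {n : ℕ} (hn : Module.finrank ℂ V = n)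
    {ι : Type*} [Fintype ι] (e : OrthonormalBasis ι ℂ V) :
    ∑ i, defect T (e i) =
      ∑ i : Fin n, T.singularValues i ^ 2 * (1 - T.singularValues i ^ 2) := by
  obtain ⟨b, hb⟩ := exists_singular_basis T hn
  set P := T.adjoint ∘ₗ T
  have h := (LinearMap.trace_eq_sum_inner (P ∘ₗ P) e).symm.trans
    (LinearMap.trace_eq_sum_inner (P ∘ₗ P) b)
  have h1 : ∑ i, ⟪e i, (P ∘ₗ P) (e i)⟫_ℂ = ((∑ i, ‖T.adjoint (T (e i))‖ ^ 2 : ℝ) : ℂ) := by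
    rw [Complex.ofReal_sum]
    refine Finset.sum_congr rfl fun i _ => ?_
    simp only [P, LinearMap.comp_apply]
    rw [LinearMap.adjoint_inner_right, ← LinearMap.adjoint_inner_left,
      inner_self_eq_norm_sq_to_K]
    simp
  have h2 : ∑ i, ⟪b i, (P ∘ₗ P) (b i)⟫_ℂ =
      ((∑ i : Fin n, (T.singularValues i ^ 2) ^ 2 : ℝ) : ℂ) := by
    rw [Complex.ofReal_sum]
    refine Finset.sum_congr rfl fun i _ => ?_
    simp only [P, LinearMap.comp_apply]
    rw [hb, map_smul, map_smul, hb, inner_smul_right, inner_smul_right,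
      inner_self_eq_norm_sq_to_K, b.norm_eq_one]
    push_cast
    simp [sq]
  rw [h1, h2] at h
  have h3 : ∑ i, ‖T.adjoint (T (e i))‖ ^ 2 = ∑ i : Fin n, (T.singularValues i ^ 2) ^ 2 := by
    exact_mod_cast h
  unfold defect
  rw [Finset.sum_sub_distrib, h3, sum_norm_sq_apply T hn e, ← Finset.sum_sub_distrib]
  exact Finset.sum_congr rfl fun i _ => by ring

end Spectral

/-! ### Submatrices of unitary matrices -/

section UnitarySubmatrix

theorem star_dotProduct_self_eq_sum_norm_sq {n : Type*} [Fintype n] (x : n → ℂ) :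
    star x ⬝ᵥ x = ((∑ i, ‖x i‖ ^ 2 : ℝ) : ℂ) := by
  rw [Complex.ofReal_sum]
  refine Finset.sum_congr rfl fun i _ => ?_
  rw [Pi.star_apply, Complex.star_def, Complex.conj_mul']
  simp

theorem sum_norm_sq_conjTranspose_mulVec {m n : Type*} [Fintype m] [Fintype n] [DecidableEq m]
    {C : Matrix m n ℂ} (hC : C * Cᴴ = 1) (w : m → ℂ) :
    ∑ j, ‖(Cᴴ *ᵥ w) j‖ ^ 2 = ∑ i, ‖w i‖ ^ 2 := by
  have h : star (Cᴴ *ᵥ w) ⬝ᵥ (Cᴴ *ᵥ w) = star w ⬝ᵥ w := by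
    rw [Matrix.star_mulVec, Matrix.conjTranspose_conjTranspose, ← Matrix.dotProduct_mulVec,
      Matrix.mulVec_mulVec, hC, Matrix.one_mulVec]
  rw [star_dotProduct_self_eq_sum_norm_sq, star_dotProduct_self_eq_sum_norm_sq] at h
  exact_mod_cast h

/-- The Gram matrix of the columns of the rows `rows` of `U`. For a unitary `U` it is the
orthogonal projection onto the span of the conjugates of these rows. -/
def rowKernel {L M : ℕ} (U : Matrix (Fin M) (Fin M) ℂ) (rows : Fin L → Fin M) :
    Matrix (Fin M) (Fin M) ℂ :=
  (U.submatrix rows id)ᴴ * U.submatrix rows id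

/-- For a submatrix of a unitary matrix, the quadratic form `defect` measures the part of the
row-projected vector that leaks out of the selected columns. -/
theorem defect_submatrix {L M : ℕ} {U : Matrix (Fin M) (Fin M) ℂ} (hU : U * Uᴴ = 1)
    (rows cols : Fin L ↪o Fin M) (v : EuclideanSpace ℂ (Fin L)) :
    defect (Matrix.toEuclideanLin (U.submatrix rows cols)) v =
      ∑ j with j ∉ Set.range cols, ‖∑ n, rowKernel U rows j (cols n) * v n‖ ^ 2 := by
  classical
  set A := U.submatrix rows cols with hA
  set C := U.submatrix rows id with hC
  have hCC : C * Cᴴ = 1 := by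
    rw [hC, Matrix.conjTranspose_submatrix, ← Matrix.submatrix_mul _ _ _ _ _ Function.bijective_id,
      hU, Matrix.submatrix_one _ rows.injective]
  set w : Fin L → ℂ := A *ᵥ v.ofLp with hw
  set u : Fin M → ℂ := Cᴴ *ᵥ w with hu
  have hu' : ∀ j, u j = ∑ n, rowKernel U rows j (cols n) * v n := by
    intro j
    rw [hu, hw, Matrix.mulVec_mulVec, Matrix.mulVec, dotProduct]
    rfl
  have h1 : ‖Matrix.toEuclideanLin A v‖ ^ 2 = ∑ j, ‖u j‖ ^ 2 := by
    rw [hu, sum_norm_sq_conjTranspose_mulVec hCC, EuclideanSpace.norm_sq_eq]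
    rfl
  have h2 : ‖(Matrix.toEuclideanLin A).adjoint (Matrix.toEuclideanLin A v)‖ ^ 2 =
      ∑ j with j ∈ Set.range cols, ‖u j‖ ^ 2 := by
    rw [← Matrix.toEuclideanLin_conjTranspose_eq_adjoint, EuclideanSpace.norm_sq_eq]
    have : (Finset.univ.filter fun j => j ∈ Set.range cols) =
        Finset.univ.map cols.toEmbedding := by ext; simp
    rw [this, Finset.sum_map]
    rfl
  unfold defect
  rw [h1, h2, ← Finset.sum_filter_add_sum_filter_not Finset.univ (fun j => j ∈ Set.range cols),
    add_sub_cancel_left]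
  exact Finset.sum_congr rfl fun j _ => by rw [hu']

end UnitarySubmatrix

/-! ### The discrete Fourier transform -/

section DFT

/-- The primitive root of unity `e^{2πj/M}`. -/
noncomputable def rootOfUnity (M : ℕ) : ℂ := Complex.exp (2 * Real.pi * Complex.I / M)

theorem rootOfUnity_pow_self {M : ℕ} (hM : 0 < M) : rootOfUnity M ^ M = 1 :=
  (Complex.isPrimitiveRoot_exp M hM.ne').pow_eq_one

theorem conj_rootOfUnity (M : ℕ) : conj (rootOfUnity M) = (rootOfUnity M)⁻¹ := by
  rw [rootOfUnity, ← Complex.exp_conj, ← Complex.exp_neg]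
  congr 1
  rw [map_div₀, map_mul, map_mul, Complex.conj_I, Complex.conj_ofReal, map_ofNat, map_natCast]
  ring

theorem rootOfUnity_ne_zero (M : ℕ) : rootOfUnity M ≠ 0 := Complex.exp_ne_zero _

theorem dftMatrix_apply (M : ℕ) (m n : Fin M) :
    dftMatrix M m n = (1 / (Real.sqrt M : ℂ)) * (rootOfUnity M)⁻¹ ^ ((m : ℕ) * (n : ℕ)) := by
  rw [dftMatrix, Matrix.of_apply, rootOfUnity, ← Complex.exp_neg, ← Complex.exp_nat_mul]
  congr 2
  push_cast
  ring

theorem conj_dftMatrix_apply (M : ℕ) (m n : Fin M) :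
    conj (dftMatrix M m n) = (1 / (Real.sqrt M : ℂ)) * rootOfUnity M ^ ((m : ℕ) * (n : ℕ)) := by
  rw [dftMatrix_apply, map_mul, map_pow, map_inv₀, conj_rootOfUnity, inv_inv]
  congr 1
  rw [map_div₀, Complex.conj_ofReal, map_one]

theorem one_div_sqrt_mul_self {M : ℕ} :
    (1 / (Real.sqrt M : ℂ)) * (1 / (Real.sqrt M : ℂ)) = 1 / M := by
  rw [div_mul_div_comm, one_mul, ← Complex.ofReal_mul, Real.mul_self_sqrt (Nat.cast_nonneg M)]
  simp

theorem dftMatrix_mul_conjTranspose {M : ℕ} (hM : 0 < M) :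
    dftMatrix M * (dftMatrix M)ᴴ = 1 := by
  have hp : IsPrimitiveRoot (rootOfUnity M) M := Complex.isPrimitiveRoot_exp M hM.ne'
  have hM' : (M : ℂ) ≠ 0 := by exact_mod_cast hM.ne'
  ext i k
  have h : ∀ n : Fin M, dftMatrix M i n * (dftMatrix M)ᴴ n k =
      1 / M * ((rootOfUnity M)⁻¹ ^ (i : ℕ) * rootOfUnity M ^ (k : ℕ)) ^ (n : ℕ) := by
    intro n
    rw [Matrix.conjTranspose_apply, Complex.star_def, conj_dftMatrix_apply, dftMatrix_apply,
      mul_mul_mul_comm, one_div_sqrt_mul_self, mul_pow, ← pow_mul, ← pow_mul]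
  rw [Matrix.mul_apply, Finset.sum_congr rfl fun n _ => h n, ← Finset.mul_sum,
    Fin.sum_univ_eq_sum_range
      (fun n => ((rootOfUnity M)⁻¹ ^ (i : ℕ) * rootOfUnity M ^ (k : ℕ)) ^ n)]
  by_cases hik : i = k
  · subst hik
    rw [← mul_pow, inv_mul_cancel₀ (rootOfUnity_ne_zero M)]
    simp [hM']
  · rw [Matrix.one_apply_ne hik, geom_sum_eq]
    · rw [mul_pow, ← pow_mul, ← pow_mul, mul_comm (i : ℕ), mul_comm (k : ℕ), pow_mul, pow_mul,
        inv_pow, rootOfUnity_pow_self hM]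
      simp
    · intro h1
      apply hik
      have h2 : rootOfUnity M ^ (i : ℕ) = rootOfUnity M ^ (k : ℕ) := by
        rw [inv_pow] at h1
        exact eq_of_inv_mul_eq_one h1
      exact Fin.ext (hp.pow_inj i.2 k.2 h2)

theorem le_of_orderEmbedding {L M : ℕ} (s : Fin L ↪o Fin M) : L ≤ M := by
  simpa using Fintype.card_le_of_embedding s.toEmbedding

theorem eq_of_add_mod_eq {M a s t : ℕ} (hs : s < M) (ht : t < M)
    (h : (a + s) % M = (a + t) % M) : s = t := by
  have : s ≡ t [MOD M] := Nat.ModEq.add_left_cancel' a h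
  rwa [Nat.ModEq, Nat.mod_eq_of_lt hs, Nat.mod_eq_of_lt ht] at this

/-- A cyclic renumbering of the indices under which the selected ones are `0, …, L - 1`. -/
theorem SelectsConsecutive.exists_position {L M : ℕ} (hM : 0 < M) {s : Fin L ↪o Fin M}
    (hs : SelectsConsecutive s) :
    ∃ (c : ℕ) (τ : Fin M → ℕ), (∀ n, τ n < M) ∧ (∀ n : Fin M, (n : ℕ) = (c + τ n) % M) ∧
      ∀ n, n ∈ Set.range s ↔ τ n < L := by
  obtain ⟨c, hc⟩ := hs
  have hLM := le_of_orderEmbedding s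
  have hn : ∀ n : Fin M, (n : ℕ) = (c + (n + (M - c % M)) % M) % M := by
    intro n
    have := Nat.mod_lt c hM
    conv_rhs => rw [Nat.add_mod, Nat.mod_mod, ← Nat.add_mod, ← Nat.mod_add_mod,
      show c % M + (n + (M - c % M)) = n + M by omega, Nat.add_mod_right,
      Nat.mod_eq_of_lt n.2]
  refine ⟨c, fun n => (n + (M - c % M)) % M, fun n => Nat.mod_lt _ hM, hn, fun n => ?_⟩
  rw [hc]
  constructor
  · rintro ⟨t, ht, hnt⟩
    change (n + (M - c % M)) % M < L
    rwa [← eq_of_add_mod_eq (ht.trans_le hLM) (Nat.mod_lt _ hM) (hnt.symm.trans (hn n))]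
  · intro h
    exact ⟨_, h, hn n⟩

/-- A sum over cyclically consecutive indices, reordered to start at the first of them. -/
theorem SelectsConsecutive.sum_eq {L M : ℕ} {s : Fin L ↪o Fin M} {a : ℕ}
    (ha : ∀ i : Fin M, i ∈ Set.range s ↔ ∃ t : ℕ, t < L ∧ (i : ℕ) = (a + t) % M) (f : ℕ → ℂ) :
    ∑ m, f (s m) = ∑ t ∈ Finset.range L, f ((a + t) % M) := by
  have hLM := le_of_orderEmbedding s
  have h : Finset.univ.image (fun m : Fin L => ((s m : Fin M) : ℕ)) =
      (Finset.range L).image fun t => (a + t) % M := by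
    ext x
    simp only [Finset.mem_image, Finset.mem_univ, true_and, Finset.mem_range]
    constructor
    · rintro ⟨m, rfl⟩
      obtain ⟨t, ht, h⟩ := (ha (s m)).1 ⟨m, rfl⟩
      exact ⟨t, ht, h.symm⟩
    · rintro ⟨t, ht, rfl⟩
      obtain ⟨m, hm⟩ := (ha ⟨(a + t) % M, Nat.mod_lt _ (by omega)⟩).2 ⟨t, ht, rfl⟩
      exact ⟨m, by rw [hm]⟩
  rw [← Finset.sum_image (f := f) (g := fun m : Fin L => ((s m : Fin M) : ℕ)), h,
    Finset.sum_image]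
  · intro x hx y hy hxy
    simp only [Finset.coe_range, Set.mem_Iio] at hx hy
    exact eq_of_add_mod_eq (hx.trans_le hLM) (hy.trans_le hLM) hxy
  · intro x _ y _ hxy
    exact s.injective (Fin.ext hxy)

theorem sum_exp_mul_sin (θ : ℝ) (L : ℕ) :
    (∑ t ∈ Finset.range L, Complex.exp (2 * θ * Complex.I) ^ t) * Complex.sin θ =
      Complex.exp ((L - 1) * θ * Complex.I) * Complex.sin (L * θ) := by
  induction L with
  | zero => simp
  | succ k ih =>
    rw [Finset.sum_range_succ, add_mul, ih, ← Complex.exp_nat_mul]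
    simp only [Complex.sin]
    field_simp
    simp only [mul_sub, ← Complex.exp_add]
    push_cast
    ring_nf

/-- The row kernel of the DFT matrix is a Dirichlet kernel up to a phase that depends on the
position `a` of the first row; `τ` numbers the columns cyclically from an arbitrary start `c`. -/
theorem rowKernel_dftMatrix_mul_sin {L M : ℕ} (hM : 0 < M) {rows : Fin L ↪o Fin M}
    (hrows : SelectsConsecutive rows) (c : ℕ) (τ : Fin M → ℕ)
    (hτ : ∀ n : Fin M, (n : ℕ) = (c + τ n) % M) :
    ∃ a : ℕ, ∀ j n : Fin M,
      rowKernel (dftMatrix M) rows j n * Complex.sin (Real.pi * ((τ j : ℝ) - τ n) / M : ℝ) =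
        1 / M * Complex.exp ((2 * a + L - 1) * (Real.pi * ((τ j : ℝ) - τ n) / M : ℝ) * Complex.I) *
          Complex.sin (L * (Real.pi * ((τ j : ℝ) - τ n) / M : ℝ)) := by
  obtain ⟨a, ha⟩ := hrows
  refine ⟨a, fun j n => ?_⟩
  set ζ := rootOfUnity M with hζ
  have hζM : ζ ^ M = 1 := rootOfUnity_pow_self hM
  have hζ0 : ζ ≠ 0 := rootOfUnity_ne_zero M
  set θ : ℝ := Real.pi * ((τ j : ℝ) - τ n) / M with hθ
  have hred : ∀ x y x' y' : ℕ, x ≡ x' [MOD M] → y ≡ y' [MOD M] → ζ ^ (x * y) = ζ ^ (x' * y') := by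
    intro x y x' y' hx hy
    rw [pow_eq_pow_mod (x * y) hζM, pow_eq_pow_mod (x' * y') hζM, hx.mul hy]
  have hz : ζ ^ τ j * (ζ⁻¹) ^ τ n = Complex.exp (2 * θ * Complex.I) := by
    rw [hζ, rootOfUnity, ← Complex.exp_neg, ← Complex.exp_nat_mul, ← Complex.exp_nat_mul,
      ← Complex.exp_add, hθ]
    congr 1
    push_cast
    ring
  have hg : rowKernel (dftMatrix M) rows j n =
      1 / M * (Complex.exp (2 * θ * Complex.I) ^ a *
        ∑ t ∈ Finset.range L, Complex.exp (2 * θ * Complex.I) ^ t) := by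
    have h1 : rowKernel (dftMatrix M) rows j n =
        ∑ m, (fun r : ℕ => 1 / (M : ℂ) * (ζ ^ (r * j) * ζ⁻¹ ^ (r * n))) (rows m) := by
      rw [rowKernel, Matrix.mul_apply]
      refine Finset.sum_congr rfl fun m _ => ?_
      rw [Matrix.conjTranspose_apply, Matrix.submatrix_apply, Matrix.submatrix_apply,
        Complex.star_def, id, id, conj_dftMatrix_apply, dftMatrix_apply, mul_mul_mul_comm,
        one_div_sqrt_mul_self]
    refine h1.trans ((SelectsConsecutive.sum_eq ha
      (fun r : ℕ => 1 / (M : ℂ) * (ζ ^ (r * j) * ζ⁻¹ ^ (r * n)))).trans ?_)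
    rw [Finset.mul_sum, Finset.mul_sum]
    refine Finset.sum_congr rfl fun t _ => ?_
    have e1 : ζ ^ ((a + t) % M * (j : ℕ)) = ζ ^ ((a + t) * (c + τ j)) :=
      hred _ _ _ _ (Nat.mod_modEq _ _) (by rw [hτ j]; exact Nat.mod_modEq _ _)
    have e2 : ζ ^ ((a + t) % M * (n : ℕ)) = ζ ^ ((a + t) * (c + τ n)) :=
      hred _ _ _ _ (Nat.mod_modEq _ _) (by rw [hτ n]; exact Nat.mod_modEq _ _)
    have e3 : ζ ^ ((a + t) * (c + τ j)) * (ζ ^ ((a + t) * (c + τ n)))⁻¹ =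
        (ζ ^ τ j * (ζ⁻¹) ^ τ n) ^ (a + t) := by
      rw [mul_pow, ← pow_mul, ← pow_mul, inv_pow, mul_add, mul_add, pow_add, pow_add,
        mul_comm (τ j), mul_comm (τ n)]
      field_simp
    rw [inv_pow, e1, e2, e3, hz, pow_add]
  have hE : Complex.exp (2 * θ * Complex.I) ^ a * Complex.exp ((L - 1) * θ * Complex.I) =
      Complex.exp ((2 * a + L - 1) * θ * Complex.I) := by
    rw [← Complex.exp_nat_mul, ← Complex.exp_add]
    congr 1
    ring
  rw [hg]
  linear_combination (1 / M * Complex.exp (2 * θ * Complex.I) ^ a) * sum_exp_mul_sin θ L +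
    (1 / M * Complex.sin (L * θ)) * hE

theorem norm_rowKernel_dftMatrix_mul_abs_sin_le {L M : ℕ} (hM : 0 < M) {rows : Fin L ↪o Fin M}
    (hrows : SelectsConsecutive rows) (c : ℕ) (τ : Fin M → ℕ)
    (hτ : ∀ n : Fin M, (n : ℕ) = (c + τ n) % M) (j n : Fin M) :
    ‖rowKernel (dftMatrix M) rows j n‖ * |Real.sin (Real.pi * ((τ j : ℝ) - τ n) / M)| ≤ 1 / M := by
  obtain ⟨a, ha⟩ := rowKernel_dftMatrix_mul_sin hM hrows c τ hτ
  have h := congrArg norm (ha j n)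
  rw [← Complex.ofReal_sin, norm_mul, Complex.norm_real, Real.norm_eq_abs, norm_mul, norm_mul] at h
  rw [h]
  have h1 : ‖Complex.exp ((2 * a + L - 1) * (Real.pi * ((τ j : ℝ) - τ n) / M : ℝ) *
      Complex.I)‖ = 1 := by
    convert! Complex.norm_exp_ofReal_mul_I ((2 * a + L - 1) * (Real.pi * ((τ j : ℝ) - τ n) / M))
      using 3
    push_cast
    ring
  have h2 : ‖Complex.sin (L * (Real.pi * ((τ j : ℝ) - τ n) / M : ℝ))‖ ≤ 1 := by
    have : (L : ℂ) * ((Real.pi * ((τ j : ℝ) - τ n) / M : ℝ) : ℂ) =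
        ((L * (Real.pi * ((τ j : ℝ) - τ n) / M) : ℝ) : ℂ) := by push_cast; ring
    rw [this, ← Complex.ofReal_sin, Complex.norm_real]
    exact Real.abs_sin_le_one _
  rw [h1, mul_one]
  have h3 : ‖(1 / M : ℂ)‖ = 1 / M := by simp
  rw [h3]
  exact mul_le_of_le_one_right (by positivity) h2

end DFT

/-! ### The trace of `A* A - (A* A)²` -/

section TraceEstimate

theorem sum_sq_singularValue_dft {M L : ℕ} (rows cols : Fin L ↪o Fin M) :
    ∑ ℓ : Fin L, singularValue ((dftMatrix M).submatrix rows cols) ℓ ^ 2 = (L : ℝ) ^ 2 / M := by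
  have hent : ∀ i k : Fin M, ‖dftMatrix M i k‖ ^ 2 = 1 / M := by
    intro i k
    have h : conj (dftMatrix M i k) * dftMatrix M i k = 1 / M := by
      rw [conj_dftMatrix_apply, dftMatrix_apply, mul_mul_mul_comm, one_div_sqrt_mul_self, inv_pow,
        mul_inv_cancel₀ (pow_ne_zero _ (rootOfUnity_ne_zero M)), mul_one]
    rw [Complex.conj_mul'] at h
    exact Complex.ofReal_injective (by rw [Complex.ofReal_pow, h]; simp)
  have := sum_norm_sq_apply (Matrix.toEuclideanLin ((dftMatrix M).submatrix rows cols))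
    (finrank_euclideanSpace_fin) (EuclideanSpace.basisFun (Fin L) ℂ)
  unfold singularValue
  rw [← this]
  have h : ∀ i : Fin L, ‖Matrix.toEuclideanLin ((dftMatrix M).submatrix rows cols)
      (EuclideanSpace.basisFun (Fin L) ℂ i)‖ ^ 2 = L / M := by
    intro i
    rw [EuclideanSpace.norm_sq_eq]
    simp [Matrix.toLpLin_apply, hent, div_eq_mul_inv]
  rw [Finset.sum_congr rfl fun i _ => h i]
  simp
  ring

/-- On `(0, π/2)` this is `tan x > x`; the other half follows by the symmetry `x ↦ π - x`. -/
theorem inv_sin_sq_le {x : ℝ} (hx0 : 0 < x) (hxπ : x < Real.pi) :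
    (Real.sin x ^ 2)⁻¹ ≤ (x ^ 2)⁻¹ + ((Real.pi - x) ^ 2)⁻¹ + 1 := by
  have key : ∀ y, 0 < y → y < Real.pi / 2 → (Real.sin y ^ 2)⁻¹ ≤ (y ^ 2)⁻¹ + 1 := by
    intro y h0 h1
    have hs : 0 < Real.sin y := Real.sin_pos_of_pos_of_lt_pi h0 (by linarith)
    have hc : 0 < Real.cos y := Real.cos_pos_of_mem_Ioo ⟨by linarith, h1⟩
    have ht := Real.lt_tan h0 h1
    rw [Real.tan_eq_sin_div_cos, lt_div_iff₀ hc] at ht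
    have h2 : y ^ 2 * Real.cos y ^ 2 ≤ Real.sin y ^ 2 := by
      rw [← mul_pow]
      exact pow_le_pow_left₀ (by positivity) ht.le 2
    have h3 := Real.sin_sq_add_cos_sq y
    have h4 : (y ^ 2)⁻¹ + 1 = (1 + y ^ 2) / y ^ 2 := by field_simp
    rw [h4, inv_eq_one_div, div_le_div_iff₀ (by positivity) (by positivity)]
    nlinarith
  rcases lt_trichotomy x (Real.pi / 2) with h | h | h
  · have := key x hx0 h
    have : 0 ≤ ((Real.pi - x) ^ 2)⁻¹ := by positivity
    linarith
  · have h1 : 0 ≤ ((Real.pi - x) ^ 2)⁻¹ := by positivity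
    have h2 : 0 ≤ (x ^ 2)⁻¹ := by positivity
    rw [h, Real.sin_pi_div_two, ← h]
    norm_num
    linarith
  · have := key (Real.pi - x) (by linarith) (by linarith)
    rw [Real.sin_pi_sub] at this
    have : 0 ≤ (x ^ 2)⁻¹ := by positivity
    linarith

/-- A telescoping majorant of `1 / x ^ 2`. -/
theorem inv_sq_le_sub {x : ℝ} (hx : 1 ≤ x) : (x ^ 2)⁻¹ ≤ (x - 1 / 2)⁻¹ - (x + 1 / 2)⁻¹ := by
  have h1 : 0 < x - 1 / 2 := by linarith
  have h2 : 0 < x + 1 / 2 := by linarith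
  rw [inv_sub_inv h1.ne' h2.ne', inv_eq_one_div, div_le_div_iff₀ (by positivity) (by positivity)]
  nlinarith

theorem sum_Ico_inv_sub_sq_le {t L M : ℕ} (ht : t < L) (hLM : L ≤ M) :
    ∑ s ∈ Finset.Ico L M, (((s : ℝ) - t) ^ 2)⁻¹ ≤ ((L : ℝ) - t - 1 / 2)⁻¹ := by
  have htL : (t : ℝ) + 1 ≤ L := by exact_mod_cast ht
  have key : ∑ s ∈ Finset.Ico L M, (((s : ℝ) - t) ^ 2)⁻¹ ≤
      ((L : ℝ) - t - 1 / 2)⁻¹ - ((M : ℝ) - t - 1 / 2)⁻¹ := by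
    induction M, hLM using Nat.le_induction with
    | base => simp
    | succ m hm ih =>
      have hm' : (L : ℝ) ≤ m := by exact_mod_cast hm
      rw [Finset.sum_Ico_succ_top hm]
      have := inv_sq_le_sub (x := (m : ℝ) - t) (by linarith)
      push_cast
      rw [show (m : ℝ) + 1 - t - 1 / 2 = m - t + 1 / 2 by ring]
      linarith
  have hM' : (L : ℝ) ≤ M := by exact_mod_cast hLM
  have : 0 ≤ ((M : ℝ) - t - 1 / 2)⁻¹ := inv_nonneg.2 (by linarith)
  linarith

theorem sum_Ico_inv_sub_add_sq_le (t : ℕ) {L M : ℕ} (hLM : L ≤ M) :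
    ∑ s ∈ Finset.Ico L M, (((M : ℝ) - s + t) ^ 2)⁻¹ ≤ ((t : ℝ) + 1 / 2)⁻¹ := by
  have key : ∀ K, L ≤ K → K ≤ M → ∑ s ∈ Finset.Ico L K, (((M : ℝ) - s + t) ^ 2)⁻¹ ≤
      ((M : ℝ) - K + t + 1 / 2)⁻¹ - ((M : ℝ) - L + t + 1 / 2)⁻¹ := by
    intro K hK
    induction K, hK using Nat.le_induction with
    | base => simp
    | succ m hm ih =>
      intro hmM
      have hm' : (m : ℝ) + 1 ≤ M := by exact_mod_cast hmM
      rw [Finset.sum_Ico_succ_top hm]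
      have := inv_sq_le_sub (x := (M : ℝ) - m + t)
        (by have : (0 : ℝ) ≤ t := Nat.cast_nonneg t
            linarith)
      have ih := ih (by omega)
      push_cast
      rw [show (M : ℝ) - (m + 1) + t + 1 / 2 = M - m + t - 1 / 2 by ring]
      linarith
  have h := key M hLM le_rfl
  rw [sub_self, zero_add] at h
  have hM' : (L : ℝ) ≤ M := by exact_mod_cast hLM
  have : 0 ≤ ((M : ℝ) - L + t + 1 / 2)⁻¹ :=
    inv_nonneg.2 (by have : (0 : ℝ) ≤ t := Nat.cast_nonneg t
                     linarith)
  linarith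

theorem sum_range_inv_add_half_le {L : ℕ} (hL : 0 < L) :
    ∑ t ∈ Finset.range L, ((t : ℝ) + 1 / 2)⁻¹ ≤ 2 + Real.log L := by
  induction L, hL using Nat.le_induction with
  | base => norm_num
  | succ m hm ih =>
    have hm' : (0 : ℝ) < m := by exact_mod_cast hm
    rw [Finset.sum_range_succ]
    have h := Real.le_log_one_add_of_nonneg (x := 1 / (m : ℝ)) (by positivity)
    have h1 : 1 + 1 / (m : ℝ) = (m + 1) / m := by field_simp
    rw [h1, Real.log_div (by positivity) (by positivity)] at h
    have h2 : 2 * (1 / (m : ℝ)) / (1 / m + 2) = ((m : ℝ) + 1 / 2)⁻¹ := by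
      field_simp
      ring
    push_cast
    linarith

/-- The sum is the squared Hilbert–Schmidt norm of the block of the row kernel between the selected
and the remaining columns, whose entries decay like the inverse distance on the circle. The two
ends of the column window contribute `π⁻² (2 + log L)` each. -/
theorem sum_mul_one_sub_singularValue_dft_le {M L : ℕ} (hL : 0 < L)
    {rows cols : Fin L ↪o Fin M} (hrows : SelectsConsecutive rows)
    (hcols : SelectsConsecutive cols) :
    ∑ ℓ : Fin L, singularValue ((dftMatrix M).submatrix rows cols) ℓ ^ 2 *
      (1 - singularValue ((dftMatrix M).submatrix rows cols) ℓ ^ 2) ≤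
      2 / Real.pi ^ 2 * (2 + Real.log L) + 1 / 4 := by
  have hLM := le_of_orderEmbedding rows
  have hM : 0 < M := by omega
  have hMR : (0 : ℝ) < M := by exact_mod_cast hM
  obtain ⟨c, τ, hτM, hτ, hτL⟩ := hcols.exists_position hM
  have hτinj : Function.Injective τ := fun x y hxy => Fin.ext (by rw [hτ x, hτ y, hxy])
  set F : ℕ → ℕ → ℝ := fun t s => 1 / Real.pi ^ 2 * (((s : ℝ) - t) ^ 2)⁻¹ +
    1 / Real.pi ^ 2 * (((M : ℝ) - s + t) ^ 2)⁻¹ + 1 / (M : ℝ) ^ 2 with hF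
  have hF0 : ∀ t s, 0 ≤ F t s := fun t s => by positivity
  unfold singularValue
  rw [← sum_defect_apply (Matrix.toEuclideanLin ((dftMatrix M).submatrix rows cols))
    (finrank_euclideanSpace_fin) (EuclideanSpace.basisFun (Fin L) ℂ)]
  have h1 : ∀ n : Fin L, defect (Matrix.toEuclideanLin ((dftMatrix M).submatrix rows cols))
      (EuclideanSpace.basisFun (Fin L) ℂ n) ≤
        ∑ s ∈ Finset.Ico L M, F (τ (cols n)) s := by
    intro n
    rw [defect_submatrix (dftMatrix_mul_conjTranspose hM)]
    have hterm : ∀ j ∈ Finset.univ.filter (fun j => j ∉ Set.range cols),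
        ‖∑ k, rowKernel (dftMatrix M) rows j (cols k) *
          (EuclideanSpace.basisFun (Fin L) ℂ n) k‖ ^ 2 ≤ F (τ (cols n)) (τ j) := by
      intro j hj
      have hjL : L ≤ τ j := by
        have := (Finset.mem_filter.1 hj).2
        rw [hτL] at this
        omega
      have hnL : τ (cols n) < L := (hτL _).1 ⟨n, rfl⟩
      have hjM := hτM j
      have hs : (∑ k, rowKernel (dftMatrix M) rows j (cols k) *
          (EuclideanSpace.basisFun (Fin L) ℂ n) k) = rowKernel (dftMatrix M) rows j (cols n) := by
        simp
      rw [hs]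
      have hb := norm_rowKernel_dftMatrix_mul_abs_sin_le hM hrows c τ hτ j (cols n)
      have hd1 : (1 : ℝ) ≤ (τ j : ℝ) - τ (cols n) := by
        have : (τ (cols n) : ℝ) + 1 ≤ τ j := by exact_mod_cast (by omega)
        linarith
      have hd2 : (τ j : ℝ) - τ (cols n) < M := by
        have h1 : (τ j : ℝ) < M := by exact_mod_cast hjM
        have h2 : (0 : ℝ) ≤ τ (cols n) := Nat.cast_nonneg _
        linarith
      set d : ℝ := (τ j : ℝ) - τ (cols n) with hd
      have hx0 : 0 < Real.pi * d / M := by positivity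
      have hxπ : Real.pi * d / M < Real.pi := by
        rw [div_lt_iff₀ hMR]
        exact mul_lt_mul_of_pos_left hd2 Real.pi_pos
      have hsin := Real.sin_pos_of_pos_of_lt_pi hx0 hxπ
      rw [abs_of_pos hsin, ← le_div_iff₀ hsin] at hb
      have h2 := pow_le_pow_left₀ (norm_nonneg _) hb 2
      refine h2.trans ?_
      have h3 := inv_sin_sq_le hx0 hxπ
      have h4 : (1 / (M : ℝ) / Real.sin (Real.pi * d / M)) ^ 2 =
          1 / (M : ℝ) ^ 2 * (Real.sin (Real.pi * d / M) ^ 2)⁻¹ := by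
        rw [div_pow, div_pow, one_pow, div_eq_mul_inv]
      have h5 : F (τ (cols n)) (τ j) = 1 / (M : ℝ) ^ 2 * (((Real.pi * d / M) ^ 2)⁻¹ +
          ((Real.pi - Real.pi * d / M) ^ 2)⁻¹ + 1) := by
        have hMd : (M : ℝ) - d ≠ 0 := by linarith
        have e1 : Real.pi - Real.pi * d / M = Real.pi * (M - d) / M := by field_simp
        have e2 : (M : ℝ) - τ j + τ (cols n) = M - d := by rw [hd]; ring
        rw [e1]
        simp only [hF]
        rw [e2, ← hd]
        have : d ≠ 0 := by linarith
        field_simp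
      rw [h4, h5]
      gcongr
    refine (Finset.sum_le_sum hterm).trans ?_
    rw [← Finset.sum_image (f := fun s => F (τ (cols n)) s) (g := τ)
      (fun x _ y _ h => hτinj h)]
    refine Finset.sum_le_sum_of_subset_of_nonneg ?_ fun _ _ _ => hF0 _ _
    intro s hs
    obtain ⟨j, hj, rfl⟩ := Finset.mem_image.1 hs
    have := (Finset.mem_filter.1 hj).2
    rw [hτL] at this
    exact Finset.mem_Ico.2 ⟨by omega, hτM j⟩
  refine (Finset.sum_le_sum fun n _ => h1 n).trans ?_
  have h2 : ∑ n, ∑ s ∈ Finset.Ico L M, F (τ (cols n)) s ≤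
      ∑ t ∈ Finset.range L, ∑ s ∈ Finset.Ico L M, F t s := by
    rw [← Finset.sum_image (f := fun t => ∑ s ∈ Finset.Ico L M, F t s) (g := fun n => τ (cols n))
      (fun x _ y _ h => cols.injective (hτinj h))]
    refine Finset.sum_le_sum_of_subset_of_nonneg ?_ fun _ _ _ =>
      Finset.sum_nonneg fun _ _ => hF0 _ _
    intro t ht
    obtain ⟨n, _, rfl⟩ := Finset.mem_image.1 ht
    exact Finset.mem_range.2 ((hτL _).1 ⟨n, rfl⟩)
  refine h2.trans ?_
  have h3 : ∀ t ∈ Finset.range L, ∑ s ∈ Finset.Ico L M, F t s ≤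
      1 / Real.pi ^ 2 * ((L : ℝ) - t - 1 / 2)⁻¹ + 1 / Real.pi ^ 2 * ((t : ℝ) + 1 / 2)⁻¹ +
        ((M : ℝ) - L) / M ^ 2 := by
    intro t ht
    simp only [hF, Finset.sum_add_distrib, ← Finset.mul_sum]
    have a1 := sum_Ico_inv_sub_sq_le (Finset.mem_range.1 ht) hLM
    have a2 := sum_Ico_inv_sub_add_sq_le t hLM
    rw [Finset.sum_const, Nat.card_Ico, nsmul_eq_mul, Nat.cast_sub hLM, mul_one_div]
    gcongr
  refine (Finset.sum_le_sum h3).trans ?_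
  rw [Finset.sum_add_distrib, Finset.sum_add_distrib, ← Finset.mul_sum, ← Finset.mul_sum]
  have h4 : ∑ t ∈ Finset.range L, ((L : ℝ) - t - 1 / 2)⁻¹ =
      ∑ t ∈ Finset.range L, ((t : ℝ) + 1 / 2)⁻¹ := by
    rw [← Finset.sum_range_reflect]
    refine Finset.sum_congr rfl fun t ht => ?_
    have := Finset.mem_range.1 ht
    rw [Nat.cast_sub (by omega), Nat.cast_sub (by omega)]
    push_cast
    congr 1
    ring
  have h5 := sum_range_inv_add_half_le hL
  have h6 : ∑ t ∈ Finset.range L, ((M : ℝ) - L) / M ^ 2 ≤ 1 / 4 := by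
    rw [Finset.sum_const, Finset.card_range, nsmul_eq_mul, ← mul_div_assoc,
      div_le_div_iff₀ (by positivity) (by norm_num)]
    nlinarith [sq_nonneg ((M : ℝ) - 2 * L)]
  rw [h4]
  have h7 : 1 / Real.pi ^ 2 * ∑ t ∈ Finset.range L, ((t : ℝ) + 1 / 2)⁻¹ ≤
      1 / Real.pi ^ 2 * (2 + Real.log L) := by gcongr
  have h8 : 2 / Real.pi ^ 2 * (2 + Real.log L) = 2 * (1 / Real.pi ^ 2 * (2 + Real.log L)) := by
    ring
  rw [h8]
  linarith

end TraceEstimate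

/-! ### Rational functions and Cauchy kernels -/

section RationalInterpolation

/-- The rational function `∏_{j < k} (y - s j) / (y + s j)`, small on the positive half-line near
the nodes `s j` and large at their negatives. -/
noncomputable def nodeRatio (s : ℕ → ℝ) (k : ℕ) (y : ℝ) : ℝ :=
  ∏ j ∈ Finset.range k, (y - s j) / (y + s j)

/-- Up to the factor `y + Y`, the function `1 - r(y) r(Y)` is a sum of `k` products of a function
of `y` and a function of `Y`. -/
theorem one_sub_nodeRatio_mul {s : ℕ → ℝ} (hs : ∀ j, 0 < s j) (k : ℕ) {y Y : ℝ} (hy : 0 < y)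
    (hY : 0 < Y) :
    1 - nodeRatio s k y * nodeRatio s k Y =
      (y + Y) * ∑ j ∈ Finset.range k,
        (nodeRatio s j y / (y + s j)) * (2 * s j * nodeRatio s j Y / (Y + s j)) := by
  induction k with
  | zero => simp [nodeRatio]
  | succ k ih =>
    have h1 : nodeRatio s (k + 1) y = nodeRatio s k y * ((y - s k) / (y + s k)) :=
      Finset.prod_range_succ _ _
    have h2 : nodeRatio s (k + 1) Y = nodeRatio s k Y * ((Y - s k) / (Y + s k)) :=
      Finset.prod_range_succ _ _
    rw [Finset.sum_range_succ, mul_add, ← ih, h1, h2]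
    have h3 : y + s k ≠ 0 := by have := hs k; positivity
    have h4 : Y + s k ≠ 0 := by have := hs k; positivity
    field_simp
    ring

/-- If `v` is orthogonal to the `2 k` functions that occur in the expansion of
`g (1 - r(y) r(Y))`, where `g = ∑ α β / (y + Y)`, the kernel `g` acts on `v` as `r(Y) g r(y)`. -/
theorem sum_kernel_eq_of_orthogonal {n : Type*} [Fintype n] {s : ℕ → ℝ} (hs : ∀ j, 0 < s j)
    (k : ℕ) {g : n → ℂ} {y : n → ℝ} {Y : ℝ} (hy : ∀ i, 0 < y i) (hY : 0 < Y)
    {α : Fin 2 → ℂ} {β : Fin 2 → n → ℂ} (hg : ∀ i, g i * (y i + Y : ℝ) = ∑ l, α l * β l i)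
    (v : n → ℂ)
    (hv : ∀ l, ∀ j < k, ∑ i, β l i * (nodeRatio s j (y i) / (y i + s j) : ℝ) * v i = 0) :
    ∑ i, g i * v i = nodeRatio s k Y * ∑ i, g i * (nodeRatio s k (y i) * v i) := by
  have h : ∀ i, g i * v i - nodeRatio s k Y * (g i * (nodeRatio s k (y i) * v i)) =
      ∑ l, ∑ j ∈ Finset.range k, α l * ((2 * s j * nodeRatio s j Y / (Y + s j) : ℝ) : ℂ) *
        (β l i * (nodeRatio s j (y i) / (y i + s j) : ℝ) * v i) := by
    intro i
    have h1 := congrArg (fun x : ℝ => (x : ℂ)) (one_sub_nodeRatio_mul hs k (hy i) hY)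
    simp only [Complex.ofReal_mul, Complex.ofReal_sub, Complex.ofReal_one] at h1
    calc g i * v i - nodeRatio s k Y * (g i * (nodeRatio s k (y i) * v i))
        = g i * (1 - nodeRatio s k (y i) * nodeRatio s k Y) * v i := by ring
      _ = (g i * (y i + Y : ℝ)) * (∑ j ∈ Finset.range k,
          (nodeRatio s j (y i) / (y i + s j)) * (2 * s j * nodeRatio s j Y / (Y + s j)) : ℝ) *
            v i := by rw [h1]; ring
      _ = _ := by
        rw [hg, Finset.sum_mul, Finset.sum_mul]
        refine Finset.sum_congr rfl fun l _ => ?_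
        rw [Complex.ofReal_sum, Finset.mul_sum, Finset.sum_mul]
        refine Finset.sum_congr rfl fun j _ => ?_
        rw [Complex.ofReal_mul]
        ring
  rw [← sub_eq_zero, Finset.mul_sum, ← Finset.sum_sub_distrib, Finset.sum_congr rfl fun i _ => h i,
    Finset.sum_comm]
  refine Finset.sum_eq_zero fun l _ => ?_
  rw [Finset.sum_comm]
  refine Finset.sum_eq_zero fun j hj => ?_
  rw [← Finset.mul_sum, hv l j (Finset.mem_range.1 hj), mul_zero]

end RationalInterpolation

/-! ### Cauchy coordinates on the circle -/

section CauchyCoordinates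

theorem abs_sin_nat_mul_le (n : ℕ) (x : ℝ) : |Real.sin (n * x)| ≤ n * |Real.sin x| := by
  induction n with
  | zero => simp
  | succ n ih =>
    push_cast
    rw [add_mul, one_mul, Real.sin_add]
    have h1 : |Real.sin (n * x) * Real.cos x| ≤ |Real.sin (n * x)| := by
      rw [abs_mul]
      exact mul_le_of_le_one_right (abs_nonneg _) (Real.abs_cos_le_one _)
    have h2 : |Real.cos (n * x) * Real.sin x| ≤ |Real.sin x| := by
      rw [abs_mul]
      exact mul_le_of_le_one_left (abs_nonneg _) (Real.abs_cos_le_one _)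
    have := abs_add_le (Real.sin (n * x) * Real.cos x) (Real.cos (n * x) * Real.sin x)
    linarith

theorem sin_le_sin_of_le_of_le_pi_sub {x y : ℝ} (hx : 0 ≤ x) (hxy : x ≤ y)
    (hy : y ≤ Real.pi - x) : Real.sin x ≤ Real.sin y := by
  rcases le_total y (Real.pi / 2) with h | h
  · exact Real.sin_le_sin_of_le_of_le_pi_div_two (by linarith) h hxy
  · rw [← Real.sin_pi_sub y]
    exact Real.sin_le_sin_of_le_of_le_pi_div_two (by linarith) (by linarith) (by linarith)

/-- As `u` is a shift by `2 L x` of `w`, up to reflection, the addition theorem bounds `sin u` by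
`sin w + |sin (2 L x)|`, and `|sin (2 L x)| ≤ 2 L sin x ≤ 2 L sin w`. -/
theorem sin_le_mul_sin {L : ℕ} {x u w : ℝ} (hx : 0 < x)
    (hw : x ≤ w) (hw' : w ≤ Real.pi - x)
    (huw : u = 2 * L * x - w ∨ u = w + 2 * L * x ∨ u = w - 2 * L * x) :
    Real.sin u ≤ (2 * L + 1) * Real.sin w := by
  have h1 := sin_le_sin_of_le_of_le_pi_sub hx.le hw hw'
  have hs : 0 ≤ Real.sin x := Real.sin_nonneg_of_nonneg_of_le_pi hx.le (by linarith)
  have h2 := abs_sin_nat_mul_le (2 * L) x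
  push_cast at h2
  rw [abs_of_nonneg hs] at h2
  have h3 : |Real.sin (2 * L * x)| ≤ 2 * L * Real.sin w :=
    h2.trans (mul_le_mul_of_nonneg_left h1 (by positivity))
  have h4 : |Real.sin (2 * L * x) * Real.cos w| ≤ |Real.sin (2 * L * x)| := by
    rw [abs_mul]
    exact mul_le_of_le_one_right (abs_nonneg _) (Real.abs_cos_le_one _)
  have h5 : |Real.cos (2 * L * x) * Real.sin w| ≤ Real.sin w := by
    rw [abs_mul, abs_of_nonneg (hs.trans h1)]
    exact mul_le_of_le_one_left (hs.trans h1) (Real.abs_cos_le_one _)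
  have h6 := abs_le.1 (h4.trans h3)
  have h7 := abs_le.1 h5
  rcases huw with rfl | rfl | rfl
  · rw [Real.sin_sub]
    linarith
  · rw [Real.sin_add]
    linarith
  · rw [Real.sin_sub]
    linarith

/-- The coordinate, on the projective line, of the position `t` on the circle of length `M`: a
Möbius transformation of `e^{2πjt/M}` that is positive for `-1/2 < t < L - 1/2` and negative on
the complementary arc. -/
noncomputable def cauchyCoord (L M : ℕ) (t : ℝ) : ℝ :=
  Real.sin (Real.pi * (t + 1 / 2) / M) / Real.sin (Real.pi * (L - 1 / 2 - t) / M)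

/-- The selected columns have coordinates in `[1/(2L+1), 2L+1]`. -/
theorem cauchyCoord_bounds_inside {L M t : ℕ} (ht : t < L) (hLM : L ≤ M) :
    0 < cauchyCoord L M t ∧ cauchyCoord L M t ≤ 2 * L + 1 ∧
      1 ≤ (2 * L + 1) * cauchyCoord L M t := by
  have hM : (0 : ℝ) < M := by exact_mod_cast (by omega)
  have hL : (t : ℝ) + 1 ≤ L := by exact_mod_cast ht
  have hLM' : (L : ℝ) ≤ M := by exact_mod_cast hLM
  have ht0 : (0 : ℝ) ≤ t := Nat.cast_nonneg t
  set x : ℝ := Real.pi / (2 * M) with hx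
  have hx0 : 0 < x := by positivity
  have hπ : Real.pi = 2 * M * x := by rw [hx]; field_simp
  have e1 : Real.pi * (t + 1 / 2) / M = (2 * t + 1) * x := by rw [hx]; field_simp
  have e2 : Real.pi * (L - 1 / 2 - t) / M = (2 * L - 2 * t - 1) * x := by
    rw [hx]; field_simp; ring
  have a1 : x ≤ (2 * t + 1) * x := by nlinarith
  have a2 : (2 * t + 1) * x ≤ Real.pi - x := by rw [hπ]; nlinarith
  have b1 : x ≤ (2 * L - 2 * t - 1) * x := by nlinarith
  have b2 : (2 * L - 2 * t - 1) * x ≤ Real.pi - x := by rw [hπ]; nlinarith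
  have hA : 0 < Real.sin ((2 * t + 1) * x) :=
    Real.sin_pos_of_pos_of_lt_pi (by linarith) (by linarith)
  have hB : 0 < Real.sin ((2 * L - 2 * t - 1) * x) :=
    Real.sin_pos_of_pos_of_lt_pi (by linarith) (by linarith)
  unfold cauchyCoord
  rw [e1, e2]
  refine ⟨div_pos hA hB, ?_, ?_⟩
  · rw [div_le_iff₀ hB]
    exact sin_le_mul_sin hx0 b1 b2 (Or.inl (by ring))
  · rw [← mul_div_assoc, le_div_iff₀ hB, one_mul]
    exact sin_le_mul_sin hx0 a1 a2 (Or.inl (by ring))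

/-- The remaining columns have coordinates in `[-(2L+1), -1/(2L+1)]`. -/
theorem cauchyCoord_bounds_outside {L M t : ℕ} (ht : L ≤ t) (htM : t < M) :
    0 < -cauchyCoord L M t ∧ -cauchyCoord L M t ≤ 2 * L + 1 ∧
      1 ≤ (2 * L + 1) * -cauchyCoord L M t := by
  have hM : (0 : ℝ) < M := by exact_mod_cast (by omega)
  have hL : (L : ℝ) ≤ t := by exact_mod_cast ht
  have htM' : (t : ℝ) + 1 ≤ M := by exact_mod_cast htM
  have hL0 : (0 : ℝ) ≤ L := Nat.cast_nonneg L
  set x : ℝ := Real.pi / (2 * M) with hx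
  have hx0 : 0 < x := by positivity
  have hπ : Real.pi = 2 * M * x := by rw [hx]; field_simp
  have e1 : Real.pi * (t + 1 / 2) / M = (2 * t + 1) * x := by rw [hx]; field_simp
  have e2 : Real.pi * (L - 1 / 2 - t) / M = -((2 * t + 1 - 2 * L) * x) := by
    rw [hx]; field_simp; ring
  have a1 : x ≤ (2 * t + 1) * x := by nlinarith
  have a2 : (2 * t + 1) * x ≤ Real.pi - x := by rw [hπ]; nlinarith
  have b1 : x ≤ (2 * t + 1 - 2 * L) * x := by nlinarith
  have b2 : (2 * t + 1 - 2 * L) * x ≤ Real.pi - x := by rw [hπ]; nlinarith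
  have hA : 0 < Real.sin ((2 * t + 1) * x) :=
    Real.sin_pos_of_pos_of_lt_pi (by linarith) (by linarith)
  have hB : 0 < Real.sin ((2 * t + 1 - 2 * L) * x) :=
    Real.sin_pos_of_pos_of_lt_pi (by linarith) (by linarith)
  unfold cauchyCoord
  rw [e1, e2, Real.sin_neg, div_neg, neg_neg]
  refine ⟨div_pos hA hB, ?_, ?_⟩
  · rw [div_le_iff₀ hB]
    exact sin_le_mul_sin hx0 b1 b2 (Or.inr (Or.inl (by ring)))
  · rw [← mul_div_assoc, le_div_iff₀ hB, one_mul]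
    exact sin_le_mul_sin hx0 a1 a2 (Or.inr (Or.inr (by ring)))

theorem cauchyCoord_sub {L M : ℕ} {t s : ℝ}
    (ht : Real.sin (Real.pi * (L - 1 / 2 - t) / M) ≠ 0)
    (hs : Real.sin (Real.pi * (L - 1 / 2 - s) / M) ≠ 0) :
    cauchyCoord L M t - cauchyCoord L M s =
      -(Real.sin (Real.pi * L / M) * Real.sin (Real.pi * (s - t) / M)) /
        (Real.sin (Real.pi * (L - 1 / 2 - t) / M) * Real.sin (Real.pi * (L - 1 / 2 - s) / M)) := by
  unfold cauchyCoord
  rw [div_sub_div _ _ ht hs]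
  congr 1
  set lam := Real.pi * L / M with hlam
  set P := Real.pi * (t + 1 / 2) / M with hP
  set Q := Real.pi * (s + 1 / 2) / M with hQ
  rw [show Real.pi * (L - 1 / 2 - t) / M = lam - P by rw [hlam, hP]; ring,
    show Real.pi * (L - 1 / 2 - s) / M = lam - Q by rw [hlam, hQ]; ring,
    show Real.pi * (s - t) / M = Q - P by rw [hQ, hP]; ring]
  simp only [Real.sin_sub]
  ring

/-- In the coordinate `cauchyCoord` the kernel is of Cauchy type with a numerator of rank two. -/
theorem exists_rowKernel_mul_sub_eq {L M : ℕ} (hM : 0 < M) {rows : Fin L ↪o Fin M}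
    (hrows : SelectsConsecutive rows) (c : ℕ) (τ : Fin M → ℕ)
    (hτ : ∀ n : Fin M, (n : ℕ) = (c + τ n) % M) (hτM : ∀ n, τ n < M) :
    ∃ α β : Fin 2 → Fin M → ℂ, ∀ j n : Fin M, L ≤ τ j → τ n < L →
      rowKernel (dftMatrix M) rows j n *
        (cauchyCoord L M (τ n) + -cauchyCoord L M (τ j) : ℝ) = ∑ l, α l j * β l n := by
  obtain ⟨a, ha⟩ := rowKernel_dftMatrix_mul_sin hM hrows c τ hτ
  have hLM := le_of_orderEmbedding rows
  set P : Fin M → ℝ := fun n => Real.pi * τ n / M with hP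
  set D : Fin M → ℝ := fun n => Real.sin (Real.pi * (L - 1 / 2 - τ n) / M) with hD
  set S : ℝ := Real.sin (Real.pi * L / M) with hS
  refine ⟨fun l j => -(S / D j / M : ℂ) * Complex.exp ((2 * a + L - 1) * P j * Complex.I) *
      ![Complex.sin (L * P j), -Complex.cos (L * P j)] l,
    fun l n => Complex.exp (-((2 * a + L - 1) * P n * Complex.I)) / D n *
      ![Complex.cos (L * P n), Complex.sin (L * P n)] l, fun j n hj hn => ?_⟩
  have hDn : D n ≠ 0 := by
    intro h
    have := (cauchyCoord_bounds_inside hn hLM).1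
    unfold cauchyCoord at this
    simp only [hD] at h
    rw [h, div_zero] at this
    exact this.false
  have hDj : D j ≠ 0 := by
    intro h
    have := (cauchyCoord_bounds_outside hj (hτM j)).1
    unfold cauchyCoord at this
    simp only [hD] at h
    rw [h, div_zero, neg_zero] at this
    exact this.false
  have h1 := ha j n
  set θ : ℝ := Real.pi * ((τ j : ℝ) - τ n) / M with hθ
  have hθ' : (θ : ℂ) = P j - P n := by
    rw [hθ, ← Complex.ofReal_sub]
    congr 1
    simp only [hP]
    ring
  rw [← sub_eq_add_neg, cauchyCoord_sub hDn hDj]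
  change rowKernel (dftMatrix M) rows j n * ((-(S * Real.sin θ) / (D n * D j) : ℝ) : ℂ) = _
  push_cast
  have hE : Complex.exp ((2 * a + L - 1) * θ * Complex.I) =
      Complex.exp ((2 * a + L - 1) * P j * Complex.I) *
        Complex.exp (-((2 * a + L - 1) * P n * Complex.I)) := by
    rw [← Complex.exp_add, hθ']
    congr 1
    ring
  have hsin : Complex.sin (L * θ) = Complex.sin (L * P j) * Complex.cos (L * P n) -
      Complex.cos (L * P j) * Complex.sin (L * P n) := by
    rw [hθ', mul_sub, Complex.sin_sub]
  rw [hE, hsin] at h1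
  simp only [Fin.sum_univ_two, Matrix.cons_val_zero, Matrix.cons_val_one]
  linear_combination (-(S : ℂ) / (D n * D j)) * h1

/-- A rational function that is at most `δ` on the range of the coordinate `cauchyCoord` bounds
the number of eigenvalues in the transition region by twice its degree. -/
theorem card_transition_le {M L : ℕ} {rows cols : Fin L ↪o Fin M}
    (hL : 0 < L) (hrows : SelectsConsecutive rows) (hcols : SelectsConsecutive cols)
    {s : ℕ → ℝ} (hs : ∀ j, 0 < s j) (k : ℕ) {δ : ℝ}
    (hδ : ∀ y : ℝ, 0 < y → y ≤ 2 * L + 1 → 1 ≤ (2 * L + 1) * y → |nodeRatio s k y| ≤ δ) :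
    (Finset.univ.filter fun ℓ : Fin L =>
      1 / 4 * δ ^ 4 < singularValue ((dftMatrix M).submatrix rows cols) ℓ ^ 2 *
        (1 - singularValue ((dftMatrix M).submatrix rows cols) ℓ ^ 2)).card ≤ 2 * k := by
  have hLM := le_of_orderEmbedding rows
  have hM : 0 < M := by omega
  obtain ⟨c, τ, hτM, hτ, hτL⟩ := hcols.exists_position hM
  obtain ⟨α, β, hαβ⟩ := exists_rowKernel_mul_sub_eq hM hrows c τ hτ hτM
  set y : Fin L → ℝ := fun n => cauchyCoord L M (τ (cols n)) with hy
  have hyb := fun n : Fin L => cauchyCoord_bounds_inside ((hτL _).1 ⟨n, rfl⟩) hLM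
  let Φ : EuclideanSpace ℂ (Fin L) →ₗ[ℂ] (Fin 2 × Fin k → ℂ) :=
    { toFun := fun v i => ∑ n, β i.1 (cols n) *
        (nodeRatio s i.2 (y n) / (y n + s i.2) : ℝ) * v n
      map_add' := fun v w => by
        ext i
        simp [mul_add, Finset.sum_add_distrib]
      map_smul' := fun r v => by
        ext i
        simp only [PiLp.smul_apply, smul_eq_mul, RingHom.id_apply, Pi.smul_apply, Finset.mul_sum]
        exact Finset.sum_congr rfl fun n _ => by ring }
  have hcard := card_defect_eigenvalues_le
    (Matrix.toEuclideanLin ((dftMatrix M).submatrix rows cols)) (finrank_euclideanSpace_fin) Φ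
    (1 / 4 * δ ^ 4) ?_
  · simpa [singularValue] using hcard
  intro v hv
  -- on the kernel of `Φ` the leakage of `v` is at most `δ ^ 2` times that of the damped vector `v'`
  set v' : EuclideanSpace ℂ (Fin L) :=
    WithLp.toLp 2 fun n => (nodeRatio s k (y n) : ℂ) * v n with hv'
  have hδ0 : 0 ≤ δ := (abs_nonneg _).trans (hδ 1 one_pos (by
    have : (0 : ℝ) ≤ L := Nat.cast_nonneg L
    linarith) (by
    have : (0 : ℝ) ≤ L := Nat.cast_nonneg L
    linarith))
  have h1 : ‖v'‖ ^ 2 ≤ δ ^ 2 * ‖v‖ ^ 2 := by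
    rw [EuclideanSpace.norm_sq_eq, EuclideanSpace.norm_sq_eq, Finset.mul_sum]
    refine Finset.sum_le_sum fun n _ => ?_
    change ‖(nodeRatio s k (y n) : ℂ) * v n‖ ^ 2 ≤ _
    rw [norm_mul, Complex.norm_real, mul_pow]
    have := hδ (y n) (hyb n).1 (hyb n).2.1 (hyb n).2.2
    gcongr
    exact this
  have h2 : defect (Matrix.toEuclideanLin ((dftMatrix M).submatrix rows cols)) v ≤
      δ ^ 2 * defect (Matrix.toEuclideanLin ((dftMatrix M).submatrix rows cols)) v' := by
    rw [defect_submatrix (dftMatrix_mul_conjTranspose hM),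
      defect_submatrix (dftMatrix_mul_conjTranspose hM), Finset.mul_sum]
    refine Finset.sum_le_sum fun j hj => ?_
    have hjL : L ≤ τ j := by
      have := (Finset.mem_filter.1 hj).2
      rw [hτL] at this
      omega
    have hjb := cauchyCoord_bounds_outside hjL (hτM j)
    have h3 := sum_kernel_eq_of_orthogonal hs k
      (g := fun n => rowKernel (dftMatrix M) rows j (cols n)) (y := y)
      (Y := -cauchyCoord L M (τ j)) (fun n => (hyb n).1) hjb.1 (α := fun l => α l j)
      (β := fun l n => β l (cols n)) (fun n => hαβ j (cols n) hjL ((hτL _).1 ⟨n, rfl⟩)) v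
      (fun l i hi => congrFun hv (l, ⟨i, hi⟩))
    rw [h3, norm_mul, Complex.norm_real, mul_pow]
    have := hδ _ hjb.1 hjb.2.1 hjb.2.2
    gcongr
    exact this
  have h3 := defect_le_quarter (Matrix.toEuclideanLin ((dftMatrix M).submatrix rows cols)) v'
  calc _ ≤ δ ^ 2 * (1 / 4 * (δ ^ 2 * ‖v‖ ^ 2)) := h2.trans (by gcongr; exact h3.trans (by gcongr))
    _ = _ := by ring

end CauchyCoordinates

/-! ### Geometric nodes -/

section GeometricNodes

/-- The first term of the series `log ((1 + q) / (1 - q)) = 2 (q + q ^ 3 / 3 + …)`. -/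
theorem one_sub_div_one_add_le_exp {q : ℝ} (hq0 : 0 ≤ q) (hq1 : q ≤ 1) :
    (1 - q) / (1 + q) ≤ Real.exp (-(2 * q)) := by
  rcases hq1.eq_or_lt with rfl | hq1
  · simp only [sub_self, zero_div]
    positivity
  have h1 : 0 < 1 - q := by linarith
  have h := Real.le_log_one_add_of_nonneg (x := 2 * q / (1 - q)) (by positivity)
  have e1 : 1 + 2 * q / (1 - q) = (1 + q) / (1 - q) := by field_simp; ring
  have e2 : 2 * (2 * q / (1 - q)) / (2 * q / (1 - q) + 2) = 2 * q := by field_simp; ring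
  rw [e1, e2, Real.le_log_iff_exp_le (by positivity)] at h
  rw [Real.exp_neg, ← inv_div]
  gcongr

theorem abs_exp_sub_div_add_le (u x : ℝ) :
    |(Real.exp u - Real.exp x) / (Real.exp u + Real.exp x)| ≤
      Real.exp (-(2 * Real.exp (-|u - x|))) := by
  wlog h : x ≤ u generalizing u x
  · have := this x u (by linarith)
    rw [abs_sub_comm u x]
    rwa [abs_div, abs_sub_comm, add_comm (Real.exp x), ← abs_div] at this
  have h1 : (Real.exp u - Real.exp x) / (Real.exp u + Real.exp x) =
      (1 - Real.exp (-|u - x|)) / (1 + Real.exp (-|u - x|)) := by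
    rw [abs_of_nonneg (by linarith), neg_sub, Real.exp_sub]
    field_simp
  have h2 : Real.exp (-|u - x|) ≤ 1 := Real.exp_le_one_iff.2 (by simp)
  rw [h1, abs_of_nonneg (div_nonneg (by linarith) (by positivity))]
  exact one_sub_div_one_add_le_exp (Real.exp_pos _).le h2

theorem abs_nodeRatio_exp_le (x : ℕ → ℝ) (k : ℕ) (u : ℝ) :
    |nodeRatio (fun j => Real.exp (x j)) k (Real.exp u)| ≤
      Real.exp (-(2 * ∑ j ∈ Finset.range k, Real.exp (-|u - x j|))) := by
  rw [nodeRatio, Finset.abs_prod, Finset.mul_sum, ← Finset.sum_neg_distrib, Real.exp_sum]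
  exact Finset.prod_le_prod (fun _ _ => abs_nonneg _) fun j _ => abs_exp_sub_div_add_le u (x j)

/-- Summing the two geometric series of the `n` nodes on either side of `u`. -/
theorem le_sum_exp_neg_abs {h u : ℝ} (hh : 0 < h) {n N : ℕ} (hu : |u| ≤ h * (N - n)) :
    (1 - Real.exp (-(n * h))) / Real.sinh (h / 2) ≤
      ∑ j ∈ Finset.range (2 * N + 1), Real.exp (-|u - ((j : ℝ) - N) * h|) := by
  obtain ⟨hu1, hu2⟩ := abs_le.1 hu
  have hw0 : (n : ℝ) ≤ u / h + N := by
    have : (n : ℝ) - N ≤ u / h := by rw [le_div_iff₀ hh]; linarith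
    linarith
  have hw1 : u / h + N ≤ 2 * N - n := by
    have : u / h ≤ N - n := by rw [div_le_iff₀ hh]; linarith
    linarith
  set m := ⌊u / h + N⌋₊ with hm
  have hm0 : (m : ℝ) ≤ u / h + N :=
    Nat.floor_le ((Nat.cast_nonneg n).trans hw0)
  have hm1 : u / h + N < m + 1 := Nat.lt_floor_add_one _
  have hnm : n ≤ m := Nat.le_floor hw0
  have hmN : m + n ≤ 2 * N := by
    have : (m : ℝ) + n ≤ 2 * N := by linarith
    exact_mod_cast this
  -- `v` is the offset of `u` from the node with index `m`
  set v : ℝ := u - ((m : ℝ) - N) * h with hv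
  have hv0 : 0 ≤ v := by
    have : ((m : ℝ) - N) * h ≤ u := by
      rw [← le_div_iff₀ hh]; linarith
    linarith
  have hv1 : v ≤ h := by
    have : u ≤ ((m : ℝ) + 1 - N) * h := by
      rw [← div_le_iff₀ hh]; linarith
    rw [hv]; linarith
  set q := Real.exp (-h) with hq
  have hq1 : q < 1 := by
    rw [hq, Real.exp_lt_one_iff]
    linarith
  have hqn : ∀ i : ℕ, q ^ i = Real.exp (-(i * h)) := fun i => by
    rw [hq, ← Real.exp_nat_mul]; ring_nf
  have hgeom : ∑ i ∈ Finset.range n, q ^ i = (1 - q ^ n) / (1 - q) := by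
    rw [geom_sum_eq hq1.ne, ← neg_div_neg_eq, neg_sub, neg_sub]
  set f : ℕ → ℝ := fun j => Real.exp (-|u - ((j : ℝ) - N) * h|) with hf
  have hleft : ∀ i ∈ Finset.range n, f (m - i) = Real.exp (-v) * q ^ i := by
    intro i hi
    have hi' := Finset.mem_range.1 hi
    have e : u - (((m - i : ℕ) : ℝ) - N) * h = v + i * h := by
      rw [Nat.cast_sub (by omega), hv]; ring
    simp only [hf]
    rw [e, abs_of_nonneg (by positivity), hqn, ← Real.exp_add]
    ring_nf
  have hright : ∀ i ∈ Finset.range n, f (m + 1 + i) = Real.exp (v - h) * q ^ i := by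
    intro i _
    have e : u - (((m + 1 + i : ℕ) : ℝ) - N) * h = -(h - v + i * h) := by
      rw [hv]; push_cast; ring
    have : 0 ≤ (i : ℝ) * h := by positivity
    simp only [hf]
    rw [e, abs_neg, abs_of_nonneg (by linarith), hqn, ← Real.exp_add]
    ring_nf
  have hsub : ∑ i ∈ Finset.range n, f (m - i) + ∑ i ∈ Finset.range n, f (m + 1 + i) ≤
      ∑ j ∈ Finset.range (2 * N + 1), f j := by
    rw [← Finset.sum_image (f := f) (g := fun i => m - i),
      ← Finset.sum_image (f := f) (g := fun i => m + 1 + i), ← Finset.sum_union]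
    · refine Finset.sum_le_sum_of_subset_of_nonneg ?_ fun _ _ _ => (Real.exp_pos _).le
      intro j hj
      simp only [Finset.mem_union, Finset.mem_image, Finset.mem_range] at hj ⊢
      omega
    · rw [Finset.disjoint_left]
      intro j hj hj'
      simp only [Finset.mem_image, Finset.mem_range] at hj hj'
      omega
    · intro a _ b _ hab
      simp only at hab
      omega
    · intro a ha b hb hab
      simp only [Finset.coe_range, Set.mem_Iio] at ha hb hab
      omega
  refine le_trans ?_ hsub
  rw [Finset.sum_congr rfl hleft, Finset.sum_congr rfl hright, ← Finset.mul_sum,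
    ← Finset.mul_sum, ← add_mul, hgeom, hqn]
  have hamgm : 2 * Real.exp (-(h / 2)) ≤ Real.exp (-v) + Real.exp (v - h) := by
    have e1 : Real.exp (-v) = Real.exp (-(v / 2)) ^ 2 := by
      rw [← Real.exp_nat_mul]; congr 1; push_cast; ring
    have e2 : Real.exp (v - h) = Real.exp ((v - h) / 2) ^ 2 := by
      rw [← Real.exp_nat_mul]; congr 1; push_cast; ring
    have e3 : Real.exp (-(h / 2)) = Real.exp (-(v / 2)) * Real.exp ((v - h) / 2) := by
      rw [← Real.exp_add]; congr 1; ring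
    rw [e1, e2, e3]
    nlinarith [sq_nonneg (Real.exp (-(v / 2)) - Real.exp ((v - h) / 2))]
  have hn1 : 0 ≤ 1 - Real.exp (-(n * h)) := by
    have : Real.exp (-(n * h)) ≤ 1 := Real.exp_le_one_iff.2 (by
      have : 0 ≤ (n : ℝ) * h := by positivity
      linarith)
    linarith
  have hq1' : 0 < 1 - q := by linarith
  calc (1 - Real.exp (-(n * h))) / Real.sinh (h / 2)
      = 2 * Real.exp (-(h / 2)) * ((1 - Real.exp (-(n * h))) / (1 - q)) := by
        have e4 : q = Real.exp (-(h / 2)) ^ 2 := by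
          rw [hq, ← Real.exp_nat_mul]; congr 1; push_cast; ring
        have e5 : Real.sinh (h / 2) = (1 - q) / (2 * Real.exp (-(h / 2))) := by
          rw [Real.sinh_eq, e4, Real.exp_neg]
          field_simp
        rw [e5]
        field_simp
    _ ≤ _ := by gcongr

end GeometricNodes

/-! ### The choice of the nodes -/

section Optimisation

theorem six_pow_le_factorial (n : ℕ) : 6 ^ n ≤ (2 * n + 1).factorial := by
  induction n with
  | zero => simp
  | succ n ih =>
    rw [show 2 * (n + 1) + 1 = 2 * n + 1 + 1 + 1 by ring, Nat.factorial_succ, Nat.factorial_succ,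
      pow_succ, ← mul_assoc, mul_comm (6 ^ n)]
    refine Nat.mul_le_mul ?_ ih
    nlinarith

/-- Termwise comparison of `sinh t / t` with the geometric series of `t ^ 2 / 6`. -/
theorem inv_sub_div_six_le_inv_sinh {t : ℝ} (ht : 0 < t) :
    1 / t - t / 6 ≤ 1 / Real.sinh t := by
  have hs : 0 < Real.sinh t := Real.sinh_pos_iff.2 ht
  rcases le_or_gt 1 (t ^ 2 / 6) with h | h
  · have h1 : 1 / t - t / 6 ≤ 0 := by
      rw [sub_nonpos, div_le_div_iff₀ ht (by norm_num)]
      nlinarith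
    exact h1.trans (by positivity)
  · have h1 : Real.sinh t ≤ t * (1 - t ^ 2 / 6)⁻¹ := by
      refine hasSum_le (fun n => ?_) (Real.hasSum_sinh t)
        ((hasSum_geometric_of_lt_one (by positivity) h).mul_left t)
      rw [pow_succ', pow_mul, div_pow, mul_div_assoc]
      have : (6 : ℝ) ^ n ≤ ((2 * n + 1).factorial : ℝ) := by
        exact_mod_cast six_pow_le_factorial n
      gcongr
    have h2 : 0 < 1 - t ^ 2 / 6 := by linarith
    rw [← div_eq_mul_inv, le_div_iff₀ h2] at h1
    rw [le_div_iff₀ hs]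
    have : (1 / t - t / 6) * Real.sinh t = Real.sinh t * (1 - t ^ 2 / 6) / t := by
      field_simp
    rw [this, div_le_one ht]
    exact h1

/-- With `h = 15 / log (16/ε)`, a rational function of small degree is bounded by `δ`
on `[1/B, B]`, where `δ ^ 4 / 4 ≤ ε / 2`. -/
theorem exists_nodes {B ε : ℝ} (hB : 1 ≤ B) (hε : 0 < ε) (hε' : ε < 1 / 2) :
    ∃ (s : ℕ → ℝ) (k : ℕ) (δ : ℝ), (∀ j, 0 < s j) ∧ 1 / 4 * δ ^ 4 ≤ ε / 2 ∧
      (2 * k : ℝ) ≤ 4 / 15 * (Real.log B + Real.log 16) * Real.log (16 / ε) + 10 ∧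
      ∀ y, 0 < y → y ≤ B → 1 ≤ B * y → |nodeRatio s k y| ≤ δ := by
  set Λ := Real.log (16 / ε) with hΛ
  have hlog32 : Real.log 32 = 5 * Real.log 2 := by
    rw [show (32 : ℝ) = 2 ^ 5 by norm_num, Real.log_pow]; norm_num
  have hlog16 : Real.log 16 = 4 * Real.log 2 := by
    rw [show (16 : ℝ) = 2 ^ 4 by norm_num, Real.log_pow]; norm_num
  have hlog2 := Real.log_two_gt_d9
  have hΛ32 : Real.log 32 ≤ Λ := by
    apply Real.log_le_log (by norm_num)
    rw [le_div_iff₀ hε]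
    linarith
  have hΛ0 : 0 < Λ := by linarith
  have hlogB : 0 ≤ Real.log B := Real.log_nonneg hB
  set h := 15 / Λ with hh
  have hh0 : 0 < h := by positivity
  -- `n` nodes beyond each end of `[1/B, B]` make the truncated geometric sums lose at most `1/16`
  set n := ⌈Real.log 16 / h⌉₊ with hn
  set N := ⌈Real.log B / h⌉₊ + n with hN
  have hn1 : Real.log 16 / h ≤ n := Nat.le_ceil _
  have hn2 : (n : ℝ) < Real.log 16 / h + 1 := Nat.ceil_lt_add_one (by positivity)
  have hb1 : Real.log B / h ≤ ⌈Real.log B / h⌉₊ := Nat.le_ceil _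
  have hb2 : (⌈Real.log B / h⌉₊ : ℝ) < Real.log B / h + 1 := Nat.ceil_lt_add_one (by positivity)
  have hNn : (N : ℝ) - n = ⌈Real.log B / h⌉₊ := by rw [hN]; push_cast; ring
  refine ⟨fun j => Real.exp (((j : ℝ) - N) * h), 2 * N + 1,
    Real.exp (-(2 * ((15 / 16) / Real.sinh (h / 2)))), fun j => Real.exp_pos _, ?_, ?_, ?_⟩
  · have h1 := inv_sub_div_six_le_inv_sinh (t := h / 2) (by positivity)
    have h2 : 1 / (h / 2) = Λ / (15 / 2) := by rw [hh]; field_simp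
    have h3 : h / 2 = (15 / 2) / Λ := by rw [hh]; field_simp
    have h4 : (15 / 2) / Λ ≤ 2.165 := by
      rw [div_le_iff₀ hΛ0]
      linarith
    have h5 : Λ - Real.log 32 ≤ (15 / 2) * (1 / Real.sinh (h / 2)) := by
      rw [h2] at h1
      rw [h3] at h1 ⊢
      linarith
    rw [← Real.exp_nat_mul]
    have h6 : ((4 : ℕ) : ℝ) * -(2 * ((15 / 16) / Real.sinh (h / 2))) =
        -((15 / 2) * (1 / Real.sinh (h / 2))) := by
      push_cast; ring
    rw [h6]
    have h7 : Real.exp (-((15 / 2) * (1 / Real.sinh (h / 2)))) ≤ 2 * ε := by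
      rw [← Real.le_log_iff_exp_le (by positivity)]
      have : Real.log (2 * ε) = Real.log 32 - Λ := by
        rw [hΛ, ← Real.log_div (by norm_num) (by positivity)]
        congr 1
        field_simp
        norm_num
      linarith
    linarith
  · have e : ∀ x : ℝ, x / h = x * Λ / 15 := fun x => by rw [hh]; field_simp
    have e1 := e (Real.log 16)
    have e2 := e (Real.log B)
    push_cast
    linarith
  · intro y hy hyB hBy
    have h1 : |Real.log y| ≤ Real.log B := by
      rw [abs_le]
      constructor
      · rw [neg_le, ← Real.log_inv]
        apply Real.log_le_log (by positivity)
        rw [inv_eq_one_div, div_le_iff₀ hy]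
        exact hBy
      · exact Real.log_le_log hy hyB
    have h2 : |Real.log y| ≤ h * (N - n) := by
      rw [hNn]
      rw [div_le_iff₀ hh0] at hb1
      linarith
    have h3 := abs_nodeRatio_exp_le (fun j => ((j : ℝ) - N) * h) (2 * N + 1) (Real.log y)
    rw [Real.exp_log hy] at h3
    refine h3.trans ?_
    have h4 := le_sum_exp_neg_abs hh0 h2
    have h5 : Real.exp (-(n * h)) ≤ 1 / 16 := by
      rw [← Real.le_log_iff_exp_le (by norm_num), one_div, Real.log_inv]
      rw [div_le_iff₀ hh0] at hn1
      linarith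
    have h6 : 15 / 16 / Real.sinh (h / 2) ≤ (1 - Real.exp (-(n * h))) / Real.sinh (h / 2) := by
      have : 0 < Real.sinh (h / 2) := Real.sinh_pos_iff.2 (by positivity)
      gcongr
      linarith
    gcongr
    exact h6.trans h4

end Optimisation

/-! ### Counting numbers in the transition region -/

section Counting

/-- For numbers in `[0, 1]`, the number of those exceeding `1/2` differs from the sum by at most
`2 ∑ λ (1 - λ)`. -/
theorem abs_card_half_lt_sub_sum_le {ι : Type*} (s : Finset ι) {lam : ι → ℝ}
    (h0 : ∀ i ∈ s, 0 ≤ lam i) (h1 : ∀ i ∈ s, lam i ≤ 1) :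
    |((s.filter fun i => 1 / 2 < lam i).card : ℝ) - ∑ i ∈ s, lam i| ≤
      2 * ∑ i ∈ s, lam i * (1 - lam i) := by
  have h : ((s.filter fun i => 1 / 2 < lam i).card : ℝ) =
      ∑ i ∈ s, if 1 / 2 < lam i then 1 else 0 := by
    rw [Finset.card_filter]; push_cast; rfl
  rw [h, ← Finset.sum_sub_distrib, Finset.mul_sum]
  refine (Finset.abs_sum_le_sum_abs _ _).trans (Finset.sum_le_sum fun i hi => ?_)
  have a0 := h0 i hi
  have a1 := h1 i hi
  split_ifs with hlt
  · rw [abs_of_nonneg (by linarith)]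
    nlinarith
  · rw [zero_sub, abs_neg, abs_of_nonneg a0]
    nlinarith

/-- Two counts locate the transition of a decreasing sequence in `[0, 1]`: the number of its
members strictly between `ε` and `1 - ε`, and the size of `∑ λ (1 - λ)`. -/
theorem transition_location {L K : ℕ} {lam : ℕ → ℝ} {ε S τ R : ℝ} (hε' : ε < 1 / 2)
    (hanti : Antitone lam) (h0 : ∀ i < L, 0 ≤ lam i) (h1 : ∀ i < L, lam i ≤ 1)
    (hS : ∑ i ∈ Finset.range L, lam i = S)
    (hτ : ∑ i ∈ Finset.range L, lam i * (1 - lam i) ≤ τ)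
    (hK : ((Finset.range L).filter fun i => ε < lam i ∧ lam i < 1 - ε).card ≤ K)
    (hR : K + 2 * τ + 1 ≤ R) :
    (∀ ℓ < L, (ℓ : ℤ) ≤ ⌈2 * (⌊S / 2⌋ : ℝ) - R⌉ → 1 - ε ≤ lam ℓ) ∧
      ∀ ℓ < L, ⌊2 * (⌊S / 2⌋ : ℝ) + R + 1⌋ ≤ (ℓ : ℤ) → lam ℓ ≤ ε := by
  have hn := abs_le.1 (abs_card_half_lt_sub_sum_le (Finset.range L)
    (fun i hi => h0 i (Finset.mem_range.1 hi)) (fun i hi => h1 i (Finset.mem_range.1 hi)))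
  rw [hS] at hn
  set H := (Finset.range L).filter fun i => 1 / 2 < lam i with hH
  set G := (Finset.range L).filter fun i => ε < lam i ∧ lam i < 1 - ε with hG
  have hKG : (G.card : ℝ) ≤ K := by exact_mod_cast hK
  have hf1 : (⌊S / 2⌋ : ℝ) ≤ S / 2 := Int.floor_le _
  have hf2 : S / 2 < ⌊S / 2⌋ + 1 := Int.lt_floor_add_one _
  refine ⟨fun ℓ hℓ hle => ?_, fun ℓ hℓ hle => ?_⟩
  · by_contra! hlt
    have hle' : (ℓ : ℝ) ≤ (⌈2 * (⌊S / 2⌋ : ℝ) - R⌉ : ℝ) := by exact_mod_cast hle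
    have hc := Int.ceil_lt_add_one (2 * (⌊S / 2⌋ : ℝ) - R)
    have hsub : H ⊆ Finset.range ℓ ∪ G := by
      intro i hi
      rw [hH, Finset.mem_filter] at hi
      rw [Finset.mem_union, Finset.mem_range, hG, Finset.mem_filter]
      rcases lt_or_ge i ℓ with h | h
      · exact Or.inl h
      · exact Or.inr ⟨hi.1, by linarith, (hanti h).trans_lt hlt⟩
    have hcard : (H.card : ℝ) ≤ ℓ + G.card := by
      have := (Finset.card_le_card hsub).trans (Finset.card_union_le _ _)
      rw [Finset.card_range] at this
      exact_mod_cast this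
    linarith
  · by_contra! hlt
    have hle' : (⌊2 * (⌊S / 2⌋ : ℝ) + R + 1⌋ : ℝ) ≤ ℓ := by exact_mod_cast hle
    have hc := Int.lt_floor_add_one (2 * (⌊S / 2⌋ : ℝ) + R + 1)
    have hsub : Finset.range (ℓ + 1) ⊆ H ∪ G := by
      intro i hi
      have hiℓ : i ≤ ℓ := Nat.lt_succ_iff.1 (Finset.mem_range.1 hi)
      have hlam := hlt.trans_le (hanti hiℓ)
      rw [Finset.mem_union, hH, hG, Finset.mem_filter, Finset.mem_filter, Finset.mem_range]
      rcases lt_or_ge (1 / 2) (lam i) with h | h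
      · exact Or.inl ⟨by omega, h⟩
      · exact Or.inr ⟨by omega, hlam, by linarith⟩
    have hcard : (ℓ : ℝ) + 1 ≤ H.card + G.card := by
      have := (Finset.card_le_card hsub).trans (Finset.card_union_le _ _)
      rw [Finset.card_range] at this
      exact_mod_cast this
    linarith

end Counting

/-! ### The location and width of the transition region -/

/-- The comparison of constants: the eigenvalue count `2 k` of the transition region together with
the deviation of the trace stays below `transitionBound`. -/
theorem budget_le_transitionBound {L M : ℕ} (hL : 0 < L) {ε : ℝ} (hε : 0 < ε) (hε' : ε < 1 / 2)
    {k : ℕ} (hk : (2 * k : ℝ) ≤ 4 / 15 * (Real.log (2 * L + 1) + Real.log 16) *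
      Real.log (16 / ε) + 10) :
    ((2 * k : ℕ) : ℝ) + 2 * (2 / Real.pi ^ 2 * (2 + Real.log L) + 1 / 4) + 1 ≤
      transitionBound L M ε := by
  have hL1 : (1 : ℝ) ≤ L := by exact_mod_cast hL
  have hx : 0 ≤ Real.log L := Real.log_nonneg hL1
  have hlog2 := Real.log_two_gt_d9
  have hlog2' := Real.log_two_lt_d9
  have hlog32 : Real.log 32 = 5 * Real.log 2 := by
    rw [show (32 : ℝ) = 2 ^ 5 by norm_num, Real.log_pow]; norm_num
  have hlog16 : Real.log 16 = 4 * Real.log 2 := by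
    rw [show (16 : ℝ) = 2 ^ 4 by norm_num, Real.log_pow]; norm_num
  have hlog8 : Real.log (8 * L) = 3 * Real.log 2 + Real.log L := by
    rw [Real.log_mul (by norm_num) (by positivity), show (8 : ℝ) = 2 ^ 3 by norm_num,
      Real.log_pow]
    norm_num
  have hlogB : Real.log (2 * L + 1) ≤ 2 * Real.log 2 + Real.log L := by
    have : Real.log (2 * L + 1) ≤ Real.log (2 ^ 2 * L) :=
      Real.log_le_log (by positivity) (by linarith)
    rwa [Real.log_mul (by norm_num) (by positivity), Real.log_pow] at this
  set Λ := Real.log (16 / ε) with hΛ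
  have hΛ32 : Real.log 32 ≤ Λ := by
    apply Real.log_le_log (by norm_num)
    rw [le_div_iff₀ hε]
    linarith
  set x := Real.log L with hxdef
  have hP1 : 0.405 ≤ 4 / Real.pi ^ 2 := by
    rw [le_div_iff₀ (by positivity)]
    nlinarith [Real.pi_lt_d6, Real.pi_pos]
  have hP2 : 4 / Real.pi ^ 2 ≤ 0.4054 := by
    rw [div_le_iff₀ (by positivity)]
    nlinarith [Real.pi_gt_d6]
  have e : 2 / Real.pi ^ 2 = (4 / Real.pi ^ 2) / 2 := by ring
  set P := 4 / Real.pi ^ 2 with hP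
  have hΛ3 : 3.465 ≤ Λ := by linarith
  have hmax : 0 ≤ 2 * max (-Real.log (8 * Real.pi * (((M : ℝ) / L) ^ 2 - 1) * ε) /
      Real.log ((M : ℝ) / L)) 0 := by positivity
  have hB : 4 / 15 * (Real.log (2 * L + 1) + Real.log 16) * Λ ≤
      4 / 15 * (6 * Real.log 2 + x) * Λ := by
    have : 0 ≤ Λ := by linarith
    exact mul_le_mul_of_nonneg_right (by linarith) this
  have hR : (P * (3 * Real.log 2 + x) + 6) * Λ ≤ transitionBound L M ε := by
    unfold transitionBound
    rw [hlog8]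
    linarith
  refine le_trans ?_ hR
  rw [e]
  push_cast
  -- the coefficients of `log L` on the two sides: `4/15 * Λ + P ≤ P * Λ`
  have c1 : (4 / 15 * Λ + P) * x ≤ P * Λ * x := by
    have : 4 / 15 * Λ + P ≤ P * Λ := by nlinarith
    gcongr
  have c2 : 8 / 5 * Real.log 2 * Λ ≤ 2 * Λ := by nlinarith
  have c3 : 0 ≤ P * (3 * Real.log 2) * Λ := by
    have : 0 ≤ Λ := by linarith
    positivity
  nlinarith

theorem corollary1 (M p L : ℕ) (hM : 0 < M) (hp : 2 ≤ p) (hL : (L : ℝ) = (M : ℝ) / (p : ℝ))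
    (rows cols : Fin L ↪o Fin M)
    (hrows : SelectsConsecutive rows) (hcols : SelectsConsecutive cols)
    (ε : ℝ) (hε : 0 < ε) (hε' : ε < 1 / 2) :
    (∀ ℓ : ℕ, ℓ < L →
      (ℓ : ℤ) ≤ ⌈2 * (⌊(L : ℝ) / (2 * (p : ℝ))⌋ : ℝ) - transitionBound L M ε⌉ →
      Real.sqrt (1 - ε) ≤ singularValue ((dftMatrix M).submatrix rows cols) ℓ) ∧
    (∀ ℓ : ℕ, ℓ < L →
      ⌊2 * (⌊(L : ℝ) / (2 * (p : ℝ))⌋ : ℝ) + transitionBound L M ε + 1⌋ ≤ (ℓ : ℤ) →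
      singularValue ((dftMatrix M).submatrix rows cols) ℓ ≤ Real.sqrt ε) ∧
    (({ℓ : ℕ | ℓ < L ∧
        Real.sqrt ε < singularValue ((dftMatrix M).submatrix rows cols) ℓ ∧
        singularValue ((dftMatrix M).submatrix rows cols) ℓ < Real.sqrt (1 - ε)}.ncard : ℝ) ≤
      2 * transitionBound L M ε) := by
  have hMR : (0 : ℝ) < M := by exact_mod_cast hM
  have hpR : (0 : ℝ) < p := by exact_mod_cast (by omega)
  have hLR : (0 : ℝ) < L := by rw [hL]; positivity
  have hL0 : 0 < L := by exact_mod_cast hLR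
  set σ : ℕ → ℝ := fun ℓ => singularValue ((dftMatrix M).submatrix rows cols) ℓ with hσ
  have hσ0 : ∀ ℓ, 0 ≤ σ ℓ := fun ℓ => LinearMap.singularValues_nonneg _ ℓ
  set lam : ℕ → ℝ := fun ℓ => σ ℓ ^ 2 with hlam
  have hanti : Antitone lam := fun i j hij =>
    pow_le_pow_left₀ (hσ0 j) (LinearMap.singularValues_antitone _ hij) 2
  have h0 : ∀ i, 0 ≤ lam i := fun i => sq_nonneg _
  have h1 : ∀ i < L, lam i ≤ 1 := by
    intro i hi
    have h : 0 ≤ lam i * (1 - lam i) := mul_one_sub_sq_singularValues_nonneg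
      (Matrix.toEuclideanLin ((dftMatrix M).submatrix rows cols)) finrank_euclideanSpace_fin
      (fun v => by
        rw [defect_submatrix (dftMatrix_mul_conjTranspose hM)]
        positivity) ⟨i, hi⟩
    nlinarith [h0 i]
  have hS : ∑ i ∈ Finset.range L, lam i = (L : ℝ) / p := by
    rw [Finset.sum_range]
    refine (sum_sq_singularValue_dft rows cols).trans ?_
    rw [sq, mul_div_assoc]
    nth_rewrite 2 [hL]
    field_simp
  have hτ : ∑ i ∈ Finset.range L, lam i * (1 - lam i) ≤
      2 / Real.pi ^ 2 * (2 + Real.log L) + 1 / 4 := by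
    rw [Finset.sum_range]
    exact sum_mul_one_sub_singularValue_dft_le hL0 hrows hcols
  obtain ⟨s, k, δ, hs, hδε, hk, hδ⟩ :=
    exists_nodes (B := 2 * L + 1) (by linarith) hε hε'
  have hK : ((Finset.range L).filter fun i => ε < lam i ∧ lam i < 1 - ε).card ≤ 2 * k := by
    refine le_trans ?_ (card_transition_le hL0 hrows hcols hs k hδ)
    rw [← Finset.card_map Fin.valEmbedding]
    refine Finset.card_le_card fun i hi => ?_
    obtain ⟨hiL, hi1, hi2⟩ := Finset.mem_filter.1 hi
    refine Finset.mem_map.2 ⟨⟨i, Finset.mem_range.1 hiL⟩, Finset.mem_filter.2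
      ⟨Finset.mem_univ _, hδε.trans_lt ?_⟩, rfl⟩
    change ε / 2 < lam i * (1 - lam i)
    nlinarith
  have hR := budget_le_transitionBound (M := M) hL0 hε hε' hk
  have hloc := transition_location hε' hanti (fun i _ => h0 i) h1 hS hτ hK hR
  have hfl : (L : ℝ) / (2 * p) = (L : ℝ) / p / 2 := by field_simp
  rw [hfl]
  refine ⟨fun ℓ hℓ hle => ?_, fun ℓ hℓ hle => ?_, ?_⟩
  · exact (Real.sqrt_le_left (hσ0 ℓ)).2 (hloc.1 ℓ hℓ hle)
  · exact Real.le_sqrt_of_sq_le (hloc.2 ℓ hℓ hle)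
  · have hset : {ℓ : ℕ | ℓ < L ∧ Real.sqrt ε < σ ℓ ∧ σ ℓ < Real.sqrt (1 - ε)} =
        ((Finset.range L).filter fun i => ε < lam i ∧ lam i < 1 - ε : Finset ℕ) := by
      ext ℓ
      rw [Set.mem_ofPred_eq, Finset.mem_coe, Finset.mem_filter, Finset.mem_range,
        Real.lt_sqrt (hσ0 ℓ), ← Real.sqrt_lt_sqrt_iff hε.le, Real.sqrt_sq (hσ0 ℓ)]
    rw [hset, Set.ncard_coe_finset]
    have hK' : (((Finset.range L).filter fun i => ε < lam i ∧ lam i < 1 - ε).card : ℝ) ≤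
        ((2 * k : ℕ) : ℝ) := by exact_mod_cast hK
    have : 0 ≤ 2 / Real.pi ^ 2 * (2 + Real.log L) := by
      have := Real.log_nonneg (show (1 : ℝ) ≤ L by exact_mod_cast hL0)
      positivity
    have : (0 : ℝ) ≤ ((2 * k : ℕ) : ℝ) := Nat.cast_nonneg _
    linarith
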